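/- **Setting.** Let $\mathcal B_1=\{\theta\in\mathbb R^d:\|\theta\|_1\le 1\}$ and let $(\mathcal F_t)_{t\ge 0}$ be a filtration on a probability space, with $\mathbb E_{t-1}=\mathbb E[\,\cdot\mid\mathcal F_{t-1}]$. Let $\ell_t:\mathbb R^d\to\mathbb R$, $t\ge1$, be random convex functions, with $\ell_t(\theta)$ integrable for $\theta\in\mathcal B_1$, and let $\nabla\ell_t(\theta)$ be a (jointly measurable) choice of a subgradient of $\ell_t$ at each $\theta\in\mathcal B_1$; $\ell_t$ and $\nabla \ell_t$ are $\mathcal F_t$-measurable. Assume: - (A1) for some $G>0$, for all $t\ge 1$, almost surely $\|\nabla\ell_t(\theta)\|_\infty\le G$ for all $\theta\in\mathcal B_1$; - (A2) for some $\alpha>0$ and $\beta\in[0,1]$, for all $t\ge1$ and all $\theta_1,\theta_2\in\mathcal B_1$, almost surely $$\mathbb E_{t-1}[\ell_t(\theta_1)-\ell_t(\theta_2)]\le\mathbb E_{t-1}[\nabla\ell_t(\theta_1)^\top(\theta_1-\theta_2)]-\mathbb E_{t-1}\Big[\big(\alpha(\nabla\ell_t(\theta_1)^\top(\theta_1-\theta_2))^2\big)^{1/\beta}\Big],$$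 where for $\beta=0$ one reads $u^{1/\beta}=0$ for $0\le u\le1$ and $u^{1/\beta}=+\infty$ for $u>1$. **Algorithm (Squint/BOA).** Let $\theta_1,\dots,\theta_K\in\mathcal B_1$, $\Delta_K=\{\pi\in[0,\infty)^K:\sum_k\pi_k=1\}$, $\hat\pi_0\in\Delta_K$, $E=4G/3$, let $T\ge1$ be an integer with $\log(ET)\ge1$, and let $\eta_i=(e^iE)^{-1}$ for integers $1\le i\le\log(ET)$. For $t=1,\dots,T$ predict $\hat\theta_{t-1}=\sum_k\hat\pi_{k,t-1}\theta_k$ and, with $r_{k,s}=\nabla\ell_s(\hat\theta_{s-1})^\top(\hat\theta_{s-1}-\theta_k)$, update $$\hat\pi_{k,t}=\frac{\sum_i\eta_i\exp\big(\eta_i\sum_{s=1}^t(r_{k,s}-\eta_ir_{k,s}^2)\big)\hat\pi_{k,0}}{\sum_{i}\sum_j\hat\pi_{j,0}\,\eta_{i}\exp\big(\eta_{i}\sum_{s=1}^t(r_{j,s}-\eta_{i}r_{j,s}^2)\big)}.$$ Let $R_T(\theta)=\frac1T\sum_{t=1}^T\mathbb E_{t-1}[\ell_t(\hat\theta_{t-1})]-\frac1T\sum_{t=1}^T\mathbb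 E_{t-1}[\ell_t(\theta)]$ be the average risk and $\mathrm{KL}(\pi,\hat\pi_0)=\sum_k\pi_k\log(\pi_k/\hat\pi_{k,0})$. **Theorem.** There is a universal constant $C>0$ such that, in every such setting and for every $x>0$, with probability at least $1-2e^{-x}$, simultaneously for all $\pi\in\Delta_K$ with $\mathrm{KL}(\pi,\hat\pi_0)<\infty$, writing $a=\mathrm{KL}(\pi,\hat\pi_0)+\log\log(GT)+x$, $$\mathbb E_{k\sim\pi}[R_T(\theta_k)]\le C\left(\Big(\frac{a}{\alpha T}\Big)^{\frac1{2-\beta}}+\frac{Ga+1}{T}\right),$$ and, if moreover $G\ge1$ and $\alpha G^{2-\beta}\le1$, then on the same event $$\mathbb E_{k\sim\pi}[R_T(\theta_k)]\le C\Big(\frac{a}{\alpha T}\Big)^{\frac1{2-\beta}}.$$ -/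

import Mathlib

open MeasureTheory ProbabilityTheory

noncomputable section

namespace OnlineBOA

/-- The unit `ℓ¹`-ball of `ℝ^d`. Vectors of `ℝ^d` are functions `Fin d → ℝ`, whose norm in Mathlib
is the sup norm; the `ℓ¹`-norm is therefore written out. -/
def l1Ball (d : ℕ) : Set (Fin d → ℝ) :=
  {θ | ∑ i, |θ i| ≤ 1}

/-- `g` is a subgradient of `f : ℝ^d → ℝ` at `θ`. -/
def IsSubgradientAt {d : ℕ} (f : (Fin d → ℝ) → ℝ) (g θ : Fin d → ℝ) : Prop :=
  ∀ θ' : Fin d → ℝ, f θ + g ⬝ᵥ (θ' - θ) ≤ f θ'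

/-- Random convex losses `ℓ t ω : ℝ^d → ℝ`, `t ≥ 1`, together with a (jointly measurable) choice
`grad t ω θ` of a subgradient of `ℓ t ω` at each point `θ` of the unit `ℓ¹`-ball. Both are revealed
at time `t`, that is, adapted to the filtration `ℱ`, and the losses have a finite expectation, so
that the conditional risks make sense. -/
structure IsLossSequence {Ω : Type*} {mΩ : MeasurableSpace Ω} {d : ℕ} (μ : Measure Ω)
    (ℱ : Filtration ℕ mΩ) (ℓ : ℕ → Ω → (Fin d → ℝ) → ℝ)
    (grad : ℕ → Ω → (Fin d → ℝ) → (Fin d → ℝ)) : Prop where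
  convex : ∀ t, 1 ≤ t → ∀ ω, ConvexOn ℝ Set.univ (ℓ t ω)
  subgradient : ∀ t, 1 ≤ t → ∀ ω, ∀ θ ∈ l1Ball d, IsSubgradientAt (ℓ t ω) (grad t ω θ) θ
  measurable_loss : ∀ t, 1 ≤ t → ∀ θ : Fin d → ℝ, Measurable[ℱ t] (fun ω => ℓ t ω θ)
  measurable_grad : ∀ t, 1 ≤ t →
    Measurable[(ℱ t).prod MeasurableSpace.pi]
      (fun p : Ω × (Fin d → ℝ) => grad t p.1 p.2)
  integrable_loss : ∀ t, 1 ≤ t → ∀ θ ∈ l1Ball d, Integrable (fun ω => ℓ t ω θ) μ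

/-- Lipschitz losses: almost surely, the sup norm of the subgradients on the unit `ℓ¹`-ball is at
most `G`. -/
def LipschitzLoss {Ω : Type*} {mΩ : MeasurableSpace Ω} {d : ℕ} (μ : Measure Ω)
    (grad : ℕ → Ω → (Fin d → ℝ) → (Fin d → ℝ)) (G : ℝ) : Prop :=
  ∀ t, 1 ≤ t → ∀ᵐ ω ∂μ, ∀ θ ∈ l1Ball d, ‖grad t ω θ‖ ≤ G

/-- The power `u ^ (1/β)` for `u ≥ 0`. For `β = 0` it is the limit as `β → 0⁺` for `u < 1`, namely
`0`; the limit is infinite for `u > 1`, which `WeakExpConcave` rules out separately. -/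
def invPow (u β : ℝ) : ℝ :=
  if β = 0 then 0 else u ^ (1 / β)

/-- Weak exp-concavity with parameters `α, β`: for all `t ≥ 1` and `θ₁, θ₂` in the unit `ℓ¹`-ball,
almost surely
`E_{t-1}[ℓ_t θ₁ - ℓ_t θ₂] ≤ E_{t-1}[∇ℓ_t(θ₁)ᵀ(θ₁-θ₂)] - E_{t-1}[(α (∇ℓ_t(θ₁)ᵀ(θ₁-θ₂))²)^(1/β)]`.
For `β = 0` the exponent is `+∞`; the last expectation is finite only if the base is almost surely
at most one. -/
def WeakExpConcave {Ω : Type*} {mΩ : MeasurableSpace Ω} {d : ℕ} (μ : Measure Ω)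
    (ℱ : Filtration ℕ mΩ) (ℓ : ℕ → Ω → (Fin d → ℝ) → ℝ)
    (grad : ℕ → Ω → (Fin d → ℝ) → (Fin d → ℝ)) (α β : ℝ) : Prop :=
  ∀ t, 1 ≤ t → ∀ θ₁ ∈ l1Ball d, ∀ θ₂ ∈ l1Ball d,
    (β = 0 → ∀ᵐ ω ∂μ, α * (grad t ω θ₁ ⬝ᵥ (θ₁ - θ₂)) ^ 2 ≤ 1) ∧
    ∀ᵐ ω ∂μ,
      (μ[fun ω' => ℓ t ω' θ₁ - ℓ t ω' θ₂ | ℱ (t - 1)]) ω ≤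
        (μ[fun ω' => grad t ω' θ₁ ⬝ᵥ (θ₁ - θ₂) | ℱ (t - 1)]) ω -
          (μ[fun ω' => invPow (α * (grad t ω' θ₁ ⬝ᵥ (θ₁ - θ₂)) ^ 2) β | ℱ (t - 1)]) ω

/-- The learning rates `η_i = (e^i E)⁻¹`. -/
def learningRate (E : ℝ) (i : ℕ) : ℝ :=
  (Real.exp i * E)⁻¹

/-- The indices `1 ≤ i ≤ log (E T)` of the learning rates in use. -/
def rateIndices (E : ℝ) (T : ℕ) : Finset ℕ :=
  Finset.Icc 1 ⌊Real.log (E * T)⌋₊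

/-- The weight of the `k`-th point, when `L η k` is the value of `∑ s ≤ t, (r_{k,s} - η r_{k,s}²)`. -/
def boaWeight {K : ℕ} (E : ℝ) (T : ℕ) (prior : Fin K → ℝ) (L : ℝ → Fin K → ℝ) (k : Fin K) : ℝ :=
  (∑ i ∈ rateIndices E T, learningRate E i *
      Real.exp (learningRate E i * L (learningRate E i) k) * prior k) /
    ∑ i ∈ rateIndices E T, ∑ j, prior j * (learningRate E i *
      Real.exp (learningRate E i * L (learningRate E i) j))

/-- The prediction `∑ k, π̂_k θ_k` made with the weights of `boaWeight`. -/
def boaPredict {d K : ℕ} (E : ℝ) (T : ℕ) (prior : Fin K → ℝ) (θ : Fin K → Fin d → ℝ)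
    (L : ℝ → Fin K → ℝ) : Fin d → ℝ :=
  ∑ k, boaWeight E T prior L k • θ k

/-- `boaCum E T prior θ g t η k` is `∑ s ≤ t, (r_{k,s} - η r_{k,s}²)` along the run of the algorithm
against the subgradients `g s`, where `r_{k,s} = g_s(θ̂_{s-1})ᵀ(θ̂_{s-1} - θ_k)`. -/
def boaCum {d K : ℕ} (E : ℝ) (T : ℕ) (prior : Fin K → ℝ) (θ : Fin K → Fin d → ℝ)
    (g : ℕ → (Fin d → ℝ) → (Fin d → ℝ)) : ℕ → ℝ → Fin K → ℝ
  | 0 => fun _ _ => 0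
  | t + 1 => fun η k =>
      let p := boaPredict E T prior θ (boaCum E T prior θ g t)
      let r := g (t + 1) p ⬝ᵥ (p - θ k)
      boaCum E T prior θ g t η k + (r - η * r ^ 2)

/-- The prediction `θ̂_t` of the algorithm, made after `t` rounds. -/
def boaIterate {d K : ℕ} (E : ℝ) (T : ℕ) (prior : Fin K → ℝ) (θ : Fin K → Fin d → ℝ)
    (g : ℕ → (Fin d → ℝ) → (Fin d → ℝ)) (t : ℕ) : Fin d → ℝ :=
  boaPredict E T prior θ (boaCum E T prior θ g t)

/-- The average risk `R_T(θ)` of the predictions `pred t ω = θ̂_t`, namely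
`(1/T) ∑_{t=1}^T E_{t-1}[ℓ_t(θ̂_{t-1})] - (1/T) ∑_{t=1}^T E_{t-1}[ℓ_t(θ)]`. -/
def avgRisk {Ω : Type*} {mΩ : MeasurableSpace Ω} {d : ℕ} (μ : Measure Ω)
    (ℱ : Filtration ℕ mΩ) (ℓ : ℕ → Ω → (Fin d → ℝ) → ℝ)
    (pred : ℕ → Ω → (Fin d → ℝ)) (T : ℕ) (θ : Fin d → ℝ) (ω : Ω) : ℝ :=
  (1 / (T : ℝ)) * ∑ t ∈ Finset.Icc 1 T, (μ[fun ω' => ℓ t ω' (pred (t - 1) ω') | ℱ (t - 1)]) ω -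
    (1 / (T : ℝ)) * ∑ t ∈ Finset.Icc 1 T, (μ[fun ω' => ℓ t ω' θ | ℱ (t - 1)]) ω

/-- The Kullback-Leibler divergence `∑ k, π_k log (π_k / ρ_k)`, to be used when `ρ_k = 0` implies
`π_k = 0`; it is infinite otherwise. -/
def klFin {K : ℕ} (π ρ : Fin K → ℝ) : ℝ :=
  ∑ k, π k * Real.log (π k / ρ k)

end OnlineBOA

end

/-!
Write `r_t` for the linearized regret of the prediction against a fixed point.

* The learning rates satisfy `|η r_t| ≤ 3/5`, where `exp (z - z²) ≤ 1 + z`. The weights of the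
  algorithm make the first-order terms cancel, so the mixture of the
  `exp (η ∑ (r_t - η r_t²))` never exceeds its initial value, and the Gibbs variational principle
  gives `η ∑ (r_t - η r_t²) ≤ KL + log (number of rates)`.
* For `|z| ≤ 3/5` also `exp (z² - z) ≤ 1 - z + 4 z²`, which makes
  `exp (∑ (E_{t-1}[η r_t] - 4 E_{t-1}[(η r_t)²] - η r_t + (η r_t)²))` a supermartingale;
  Markov's inequality for the mixture over rates and points turns the previous bound into
  `η ∑ E_{t-1}[r_t] ≤ 4 η² ∑ E_{t-1}[r_t²] + O(a)`, for all rates and mixtures at once.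
* Weak exp-concavity bounds `E_{t-1}[r_t²]` by the linearization gap
  `E_{t-1}[r_t - (ℓ_t(p) - ℓ_t(u))]`: since `z ≤ c^(β-1) z^(1/β) + c^β` for all `c > 0`,
  `E_{t-1}[r_t²] ≤ (c^(β-1)/α + 4G) gap + c^β/α`. It is assumed almost surely at each fixed `p`
  only, whereas the predictions are random and the subgradients may jump; a prediction is therefore
  moved slightly towards `u`, where monotonicity keeps the subgradients under control, and then
  discretized, at the cost of the additional `4G`.
* With `η` of the order of `1/(c^(β-1)/α + 4G)` the gap absorbs the second moments, and
  `c = (a/(αT))^(1/(2-β))` balances the remaining terms.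
-/

namespace OnlineBOA

/-! ### Scalar inequalities -/

lemma exp_sub_sq_le_one_add {y : ℝ} (hy : -(3 / 5) ≤ y) : Real.exp (y - y ^ 2) ≤ 1 + y := by
  have hy1 : 0 < 1 + y := by linarith
  rw [show y - y ^ 2 = -(y ^ 2 - y) by ring, Real.exp_neg, inv_le_iff_one_le_mul₀ (Real.exp_pos _)]
  rcases le_total 0 y with h0 | h0
  · calc 1 ≤ (1 + y) * (y ^ 2 - y + 1) := by linarith [pow_nonneg h0 3]
      _ ≤ (1 + y) * Real.exp (y ^ 2 - y) :=
        mul_le_mul_of_nonneg_left (Real.add_one_le_exp _) hy1.le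
  · obtain ⟨w, rfl⟩ : ∃ w, y = -w := ⟨-y, (neg_neg y).symm⟩
    have hw : 0 ≤ w := by linarith
    set u := w + w ^ 2 with hu
    have htaylor : 1 + u + u ^ 2 / 2 + u ^ 3 / 6 ≤ Real.exp u := by
      have h := Real.sum_le_exp_of_nonneg (by positivity : 0 ≤ u) 4
      simp only [Finset.sum_range_succ, Finset.sum_range_zero, Nat.factorial] at h
      norm_num at h
      exact h
    have hquot : 0 ≤ 3 - 2 * w - w ^ 2 - 3 * w ^ 3 - 2 * w ^ 4 - w ^ 5 := by
      have hpow (n : ℕ) : w ^ n ≤ (3 / 5) ^ n := pow_le_pow_left₀ hw (by linarith) n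
      linarith [hpow 2, hpow 3, hpow 4, hpow 5]
    calc 1 ≤ 1 + w ^ 2 * (3 - 2 * w - w ^ 2 - 3 * w ^ 3 - 2 * w ^ 4 - w ^ 5) / 6 :=
          le_add_of_nonneg_right (by positivity)
      _ = (1 + -w) * (1 + u + u ^ 2 / 2 + u ^ 3 / 6) := by rw [hu]; ring
      _ ≤ (1 + -w) * Real.exp u := mul_le_mul_of_nonneg_left htaylor hy1.le
      _ = (1 + -w) * Real.exp ((-w) ^ 2 - -w) := by rw [hu]; ring_nf

lemma exp_neg_add_sq_le {y : ℝ} (hy : |y| ≤ 3 / 5) :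
    Real.exp (-y + y ^ 2) ≤ 1 - y + 4 * y ^ 2 := by
  obtain ⟨h1, h2⟩ := abs_le.mp hy
  have hquad : Real.exp (-y + y ^ 2) - 1 - (-y + y ^ 2) ≤ (-y + y ^ 2) ^ 2 :=
    (abs_le.mp (Real.abs_exp_sub_one_sub_id_le (abs_le.mpr ⟨by nlinarith, by nlinarith⟩))).2
  have hsq : (-y + y ^ 2) ^ 2 ≤ 3 * y ^ 2 :=
    calc (-y + y ^ 2) ^ 2 = (1 - y) ^ 2 * y ^ 2 := by ring
      _ ≤ 3 * y ^ 2 := mul_le_mul_of_nonneg_right (by nlinarith) (sq_nonneg y)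
  linarith

lemma invPow_nonneg {u : ℝ} (hu : 0 ≤ u) (β : ℝ) : 0 ≤ invPow u β := by
  unfold invPow
  split_ifs
  · rfl
  · exact Real.rpow_nonneg hu _

lemma invPow_le_invPow {u v β : ℝ} (hu : 0 ≤ u) (huv : u ≤ v) (hβ : 0 ≤ β) :
    invPow u β ≤ invPow v β := by
  unfold invPow
  split_ifs
  · rfl
  · exact Real.rpow_le_rpow hu huv (one_div_nonneg.mpr hβ)

lemma measurable_invPow (β : ℝ) : Measurable (invPow · β) := by
  unfold invPow
  split_ifs
  · exact measurable_const
  · fun_prop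

/-- Split according to whether `z = u ^ (1 / β)` is at most `c`: `u = z ^ β` is at most `c ^ β` or
`c ^ (β - 1) * z`. -/
lemma le_mul_invPow_add {u β c : ℝ} (hu : 0 ≤ u) (hβ : 0 ≤ β) (hβ1 : β ≤ 1) (hc : 0 < c)
    (h0 : β = 0 → u ≤ 1) : u ≤ c ^ (β - 1) * invPow u β + c ^ β := by
  unfold invPow
  split_ifs with hb
  · subst hb
    simpa using h0 rfl
  set z := u ^ (1 / β)
  have hz : 0 ≤ z := Real.rpow_nonneg hu _
  have huz : u = z ^ β := by
    rw [← Real.rpow_mul hu, one_div, inv_mul_cancel₀ hb, Real.rpow_one]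
  rcases le_total z c with hzc | hcz
  · calc u = z ^ β := huz
      _ ≤ c ^ β := Real.rpow_le_rpow hz hzc hβ
      _ ≤ c ^ (β - 1) * z + c ^ β := le_add_of_nonneg_left (by positivity)
  · calc u = z ^ (β - 1) * z := by
          rw [huz, ← Real.rpow_add_one (hc.trans_le hcz).ne', sub_add_cancel]
      _ ≤ c ^ (β - 1) * z := mul_le_mul_of_nonneg_right
          (Real.rpow_le_rpow_of_nonpos hc hcz (by linarith)) hz
      _ ≤ c ^ (β - 1) * z + c ^ β := le_add_of_nonneg_right (by positivity)

/-! ### The Kullback-Leibler divergence -/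

section KullbackLeibler

variable {K : ℕ} {π ρ : Fin K → ℝ}

lemma sum_sub_sum_le_klFin (hπ : ∀ k, 0 ≤ π k) (hρ : ∀ k, 0 ≤ ρ k)
    (hac : ∀ k, ρ k = 0 → π k = 0) : ∑ k, π k - ∑ k, ρ k ≤ klFin π ρ := by
  rw [klFin, ← Finset.sum_sub_distrib]
  refine Finset.sum_le_sum fun k _ => ?_
  rcases (hπ k).eq_or_lt with h0 | hpos
  · simpa [← h0] using hρ k
  · have hρk : 0 < ρ k := (hρ k).lt_of_ne fun h => hpos.ne' (hac k h.symm)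
    calc π k - ρ k = π k * (1 - (π k / ρ k)⁻¹) := by field_simp
      _ ≤ π k * Real.log (π k / ρ k) :=
        mul_le_mul_of_nonneg_left (Real.one_sub_inv_le_log_of_pos (by positivity)) hpos.le

lemma klFin_nonneg (hπ : π ∈ stdSimplex ℝ (Fin K)) (hρ : ρ ∈ stdSimplex ℝ (Fin K))
    (hac : ∀ k, ρ k = 0 → π k = 0) : 0 ≤ klFin π ρ := by
  simpa [hπ.2, hρ.2] using sum_sub_sum_le_klFin hπ.1 hρ.1 hac

lemma exists_pos_of_mem_stdSimplex (hπ : π ∈ stdSimplex ℝ (Fin K)) : ∃ k, 0 < π k := by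
  by_contra! h
  linarith [hπ.2, Finset.sum_nonpos fun k (_ : k ∈ Finset.univ) => h k]

lemma klFin_mul_exp_div (hπ : π ∈ stdSimplex ℝ (Fin K)) (hac : ∀ k, ρ k = 0 → π k = 0)
    (f : Fin K → ℝ) {Z : ℝ} (hZ : 0 < Z) :
    klFin π (fun k => ρ k * Real.exp (f k) / Z) =
      klFin π ρ - ∑ k, π k * f k + Real.log Z := by
  have hterm (k : Fin K) : π k * Real.log (π k / (ρ k * Real.exp (f k) / Z)) =
      π k * Real.log (π k / ρ k) - π k * f k + π k * Real.log Z := by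
    by_cases h0 : π k = 0
    · simp [h0]
    · have hρk : ρ k ≠ 0 := fun h => h0 (hac k h)
      rw [Real.log_div h0 (by positivity), Real.log_div (by positivity) hZ.ne',
        Real.log_mul hρk (Real.exp_ne_zero _), Real.log_exp, Real.log_div h0 hρk]
      ring
  simp only [klFin, hterm, Finset.sum_add_distrib, Finset.sum_sub_distrib, ← Finset.sum_mul,
    hπ.2, one_mul]

lemma sum_mul_le_klFin_add_log (hπ : π ∈ stdSimplex ℝ (Fin K)) (hρ : ∀ k, 0 ≤ ρ k)
    (hac : ∀ k, ρ k = 0 → π k = 0) {f : Fin K → ℝ} {Z : ℝ}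
    (hZ : ∑ k, ρ k * Real.exp (f k) ≤ Z) :
    ∑ k, π k * f k ≤ klFin π ρ + Real.log Z := by
  obtain ⟨k, hk⟩ := exists_pos_of_mem_stdSimplex hπ
  have hρk : 0 < ρ k := (hρ k).lt_of_ne fun h => hk.ne' (hac k h.symm)
  have hnonneg (j : Fin K) : 0 ≤ ρ j * Real.exp (f j) := mul_nonneg (hρ j) (Real.exp_pos _).le
  have hpos : 0 < Z := (Finset.sum_pos' (fun j _ => hnonneg j)
    ⟨k, Finset.mem_univ k, by positivity⟩).trans_le hZ
  have hgibbs := sum_sub_sum_le_klFin (ρ := fun k => ρ k * Real.exp (f k) / Z) hπ.1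
    (fun j => div_nonneg (hnonneg j) hpos.le) fun j hj => hac j (by simpa [hpos.ne'] using hj)
  rw [klFin_mul_exp_div hπ hac f hpos, hπ.2, ← Finset.sum_div] at hgibbs
  linarith [(div_le_one hpos).mpr hZ]

end KullbackLeibler

/-! ### The unit `ℓ¹`-ball and linearized regrets -/

section L1Ball

variable {d : ℕ} {u v : Fin d → ℝ} {g : (Fin d → ℝ) → Fin d → ℝ} {G : ℝ}

lemma mem_l1Ball_iff : v ∈ l1Ball d ↔ WithLp.toLp 1 v ∈ Metric.closedBall 0 1 := by
  simp [l1Ball, PiLp.norm_eq_of_L1]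

lemma zero_mem_l1Ball : (0 : Fin d → ℝ) ∈ l1Ball d := by
  simp [l1Ball]

lemma convex_l1Ball : Convex ℝ (l1Ball d) := by
  have h : l1Ball d = (WithLp.linearEquiv 1 ℝ (Fin d → ℝ)).symm ⁻¹' Metric.closedBall 0 1 :=
    Set.ext fun _ => mem_l1Ball_iff
  rw [h]
  exact (convex_closedBall 0 1).linear_preimage _

lemma norm_toLp_sub_le_two (hu : u ∈ l1Ball d) (hv : v ∈ l1Ball d) :
    ‖WithLp.toLp 1 (u - v)‖ ≤ 2 := by
  rw [mem_l1Ball_iff, mem_closedBall_zero_iff] at hu hv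
  calc ‖WithLp.toLp 1 u - WithLp.toLp 1 v‖ ≤ ‖WithLp.toLp 1 u‖ + ‖WithLp.toLp 1 v‖ :=
        norm_sub_le _ _
    _ ≤ 2 := by linarith

lemma abs_dotProduct_le (g v : Fin d → ℝ) : |g ⬝ᵥ v| ≤ ‖g‖ * ‖WithLp.toLp 1 v‖ := by
  rw [PiLp.norm_eq_of_L1, Finset.mul_sum]
  refine (Finset.abs_sum_le_sum_abs _ _).trans (Finset.sum_le_sum fun i _ => ?_)
  rw [abs_mul]
  exact mul_le_mul_of_nonneg_right (norm_le_pi_norm g i) (abs_nonneg _)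

/-- The linearized regret `g(v)ᵀ(v - u)` of the prediction `v` against `u`. The `r_{k,s}` of the
algorithm is the case of the subgradients `g` of `ℓ_s`, `v = θ̂_{s-1}` and `u = θ_k`. -/
noncomputable def linRegret (g : (Fin d → ℝ) → Fin d → ℝ) (v u : Fin d → ℝ) : ℝ :=
  g v ⬝ᵥ (v - u)

lemma abs_linRegret_le (hg : ‖g v‖ ≤ G) (hv : v ∈ l1Ball d) (hu : u ∈ l1Ball d) :
    |linRegret g v u| ≤ 2 * G :=
  calc |linRegret g v u| ≤ ‖g v‖ * ‖WithLp.toLp 1 (v - u)‖ := abs_dotProduct_le _ _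
    _ ≤ G * 2 := mul_le_mul hg (norm_toLp_sub_le_two hv hu) (norm_nonneg _)
      ((norm_nonneg _).trans hg)
    _ = 2 * G := mul_comm _ _

lemma sq_linRegret_le (hg : ‖g v‖ ≤ G) (hv : v ∈ l1Ball d) (hu : u ∈ l1Ball d) :
    linRegret g v u ^ 2 ≤ 4 * G ^ 2 :=
  calc linRegret g v u ^ 2 = |linRegret g v u| ^ 2 := (sq_abs _).symm
    _ ≤ (2 * G) ^ 2 := pow_le_pow_left₀ (abs_nonneg _) (abs_linRegret_le hg hv hu) 2
    _ = 4 * G ^ 2 := by ring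

end L1Ball

/-! ### The grid of learning rates -/

section LearningRate

variable {E : ℝ} {T i : ℕ}

lemma learningRate_pos (hE : 0 < E) (i : ℕ) : 0 < learningRate E i := by
  unfold learningRate
  positivity

lemma learningRate_mul (hE : 0 < E) (i : ℕ) : learningRate E i * E = Real.exp (-i) := by
  rw [learningRate, mul_inv, inv_mul_cancel_right₀ hE.ne', Real.exp_neg]

/-- As `e ≥ 5 / 2`, the largest learning rate `1 / (e E)` is at most `2 / (5 E)`. -/
lemma abs_learningRate_mul_le {G r : ℝ} (hE : 0 < E) (hGE : 4 * G ≤ 3 * E)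
    (hi : i ∈ rateIndices E T) (hr : |r| ≤ 2 * G) : |learningRate E i * r| ≤ 3 / 5 := by
  have hexp : Real.exp (-i) ≤ 2 / 5 := by
    have h1 : (1 : ℝ) ≤ i := by exact_mod_cast (Finset.mem_Icc.mp hi).1
    have he : 5 / 2 ≤ Real.exp i := by
      linarith [Real.exp_one_gt_d9, Real.exp_le_exp.mpr h1]
    calc Real.exp (-i) = (Real.exp i)⁻¹ := Real.exp_neg _
      _ ≤ (5 / 2)⁻¹ := inv_anti₀ (by norm_num) he
      _ = 2 / 5 := by norm_num
  calc |learningRate E i * r| = learningRate E i * |r| := by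
        rw [abs_mul, abs_of_pos (learningRate_pos hE i)]
    _ ≤ learningRate E i * (3 / 2 * E) :=
        mul_le_mul_of_nonneg_left (by linarith) (learningRate_pos hE i).le
    _ = 3 / 2 * Real.exp (-i) := by rw [← learningRate_mul hE]; ring
    _ ≤ 3 / 5 := by linarith

end LearningRate

/-! ### The deterministic regret bound -/

section Deterministic

variable {d K : ℕ} {E G : ℝ} {T : ℕ} {prior : Fin K → ℝ} {θ : Fin K → Fin d → ℝ}
  {g : ℕ → (Fin d → ℝ) → (Fin d → ℝ)}

/-- The unnormalized weight of the `k`-th point, the numerator of `boaWeight`. -/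
noncomputable def boaMass (E : ℝ) (T : ℕ) (prior : Fin K → ℝ) (L : ℝ → Fin K → ℝ) (k : Fin K) : ℝ :=
  ∑ i ∈ rateIndices E T, learningRate E i *
    Real.exp (learningRate E i * L (learningRate E i) k) * prior k

lemma boaWeight_eq_div (L : ℝ → Fin K → ℝ) (k : Fin K) :
    boaWeight E T prior L k = boaMass E T prior L k / ∑ j, boaMass E T prior L j := by
  simp only [boaWeight, boaMass, mul_comm (prior _)]
  rw [Finset.sum_comm (s := Finset.univ)]

lemma boaMass_nonneg (hE : 0 < E) (hprior : ∀ k, 0 ≤ prior k) (L : ℝ → Fin K → ℝ) (k : Fin K) :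
    0 ≤ boaMass E T prior L k :=
  Finset.sum_nonneg fun i _ =>
    mul_nonneg (mul_nonneg (learningRate_pos hE i).le (Real.exp_pos _).le) (hprior k)

lemma sum_boaMass_pos (hE : 0 < E) (hgrid : (rateIndices E T).Nonempty)
    (hprior : prior ∈ stdSimplex ℝ (Fin K)) (L : ℝ → Fin K → ℝ) :
    0 < ∑ k, boaMass E T prior L k := by
  obtain ⟨k, hk⟩ := exists_pos_of_mem_stdSimplex hprior
  refine Finset.sum_pos' (fun k _ => boaMass_nonneg hE hprior.1 L k) ⟨k, Finset.mem_univ k, ?_⟩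
  exact Finset.sum_pos
    (fun i _ => mul_pos (mul_pos (learningRate_pos hE i) (Real.exp_pos _)) hk) hgrid

lemma boaPredict_mem_l1Ball (hE : 0 < E) (hgrid : (rateIndices E T).Nonempty)
    (hprior : prior ∈ stdSimplex ℝ (Fin K)) (hθ : ∀ k, θ k ∈ l1Ball d) (L : ℝ → Fin K → ℝ) :
    boaPredict E T prior θ L ∈ l1Ball d := by
  have hpos := sum_boaMass_pos hE hgrid hprior L
  refine convex_l1Ball.sum_mem (fun k _ => ?_) ?_ fun k _ => hθ k
  · rw [boaWeight_eq_div]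
    exact div_nonneg (boaMass_nonneg hE hprior.1 L k) hpos.le
  · simp only [boaWeight_eq_div, ← Finset.sum_div, div_self hpos.ne']

lemma boaIterate_mem_l1Ball (hE : 0 < E) (hgrid : (rateIndices E T).Nonempty)
    (hprior : prior ∈ stdSimplex ℝ (Fin K)) (hθ : ∀ k, θ k ∈ l1Ball d) (t : ℕ) :
    boaIterate E T prior θ g t ∈ l1Ball d :=
  boaPredict_mem_l1Ball hE hgrid hprior hθ _

lemma sum_boaMass_mul_dotProduct (hE : 0 < E) (hgrid : (rateIndices E T).Nonempty)
    (hprior : prior ∈ stdSimplex ℝ (Fin K)) (L : ℝ → Fin K → ℝ) (c : Fin d → ℝ) :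
    ∑ k, boaMass E T prior L k * (c ⬝ᵥ (boaPredict E T prior θ L - θ k)) = 0 := by
  have hpos := sum_boaMass_pos hE hgrid hprior L
  have hpredict : (∑ k, boaMass E T prior L k) * (c ⬝ᵥ boaPredict E T prior θ L) =
      ∑ k, boaMass E T prior L k * (c ⬝ᵥ θ k) := by
    simp only [boaPredict, dotProduct_sum, dotProduct_smul, smul_eq_mul, boaWeight_eq_div,
      Finset.mul_sum, ← mul_assoc, mul_div_cancel₀ _ hpos.ne']
  simp only [dotProduct_sub, mul_sub, Finset.sum_sub_distrib, ← Finset.sum_mul, hpredict, sub_self]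

/-- The potential of the algorithm, the sum over the learning rates `η` of the exponential moments
`∑ k, π̂_{k,0} exp (η L_k)`, where `L η k` stands for `∑ s ≤ t, (r_{k,s} - η r_{k,s}²)`. -/
noncomputable def boaPotential (E : ℝ) (T : ℕ) (prior : Fin K → ℝ) (L : ℝ → Fin K → ℝ) : ℝ :=
  ∑ i ∈ rateIndices E T, ∑ k, prior k * Real.exp (learningRate E i * L (learningRate E i) k)

lemma boaPotential_add_le {L : ℝ → Fin K → ℝ} {r : Fin K → ℝ} (hprior : ∀ k, 0 ≤ prior k)
    (hr : ∀ i ∈ rateIndices E T, ∀ k, -(3 / 5) ≤ learningRate E i * r k) :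
    boaPotential E T prior (fun η k => L η k + (r k - η * r k ^ 2)) ≤
      boaPotential E T prior L + ∑ k, boaMass E T prior L k * r k := by
  simp only [boaPotential, boaMass, Finset.sum_mul]
  rw [Finset.sum_comm (s := Finset.univ), ← Finset.sum_add_distrib]
  refine Finset.sum_le_sum fun i hi => ?_
  rw [← Finset.sum_add_distrib]
  refine Finset.sum_le_sum fun k _ => ?_
  set η := learningRate E i
  calc prior k * Real.exp (η * (L η k + (r k - η * r k ^ 2)))
      = prior k * Real.exp (η * L η k) * Real.exp (η * r k - (η * r k) ^ 2) := by
        rw [mul_assoc, ← Real.exp_add]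
        ring_nf
    _ ≤ prior k * Real.exp (η * L η k) * (1 + η * r k) :=
        mul_le_mul_of_nonneg_left (exp_sub_sq_le_one_add (hr i hi k))
          (mul_nonneg (hprior k) (Real.exp_pos _).le)
    _ = prior k * Real.exp (η * L η k) + η * Real.exp (η * L η k) * prior k * r k := by ring

lemma boaCum_succ (t : ℕ) (η : ℝ) (k : Fin K) :
    boaCum E T prior θ g (t + 1) η k = boaCum E T prior θ g t η k +
      (linRegret (g (t + 1)) (boaIterate E T prior θ g t) (θ k) -
        η * linRegret (g (t + 1)) (boaIterate E T prior θ g t) (θ k) ^ 2) :=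
  rfl

lemma boaCum_eq_sum (t : ℕ) (η : ℝ) (k : Fin K) :
    boaCum E T prior θ g t η k = ∑ s ∈ Finset.range t,
      (linRegret (g (s + 1)) (boaIterate E T prior θ g s) (θ k) -
        η * linRegret (g (s + 1)) (boaIterate E T prior θ g s) (θ k) ^ 2) := by
  induction t with
  | zero => rfl
  | succ t ih => rw [boaCum_succ, ih, Finset.sum_range_succ]

lemma boaPotential_boaCum_le (hE : 0 < E) (hGE : 4 * G ≤ 3 * E)
    (hgrid : (rateIndices E T).Nonempty) (hprior : prior ∈ stdSimplex ℝ (Fin K))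
    (hθ : ∀ k, θ k ∈ l1Ball d) (hg : ∀ t, ∀ v ∈ l1Ball d, ‖g (t + 1) v‖ ≤ G) (t : ℕ) :
    boaPotential E T prior (boaCum E T prior θ g t) ≤ (rateIndices E T).card := by
  induction t with
  | zero => simp [boaPotential, boaCum, hprior.2]
  | succ t ih =>
    have hp := boaIterate_mem_l1Ball (g := g) hE hgrid hprior hθ t
    have hr (i) (hi : i ∈ rateIndices E T) (k : Fin K) := (abs_le.mp (abs_learningRate_mul_le hE hGE
      hi (abs_linRegret_le (hg t _ hp) hp (hθ k)))).1
    calc boaPotential E T prior (boaCum E T prior θ g (t + 1))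
        ≤ boaPotential E T prior (boaCum E T prior θ g t) + ∑ k,
            boaMass E T prior (boaCum E T prior θ g t) k *
              linRegret (g (t + 1)) (boaIterate E T prior θ g t) (θ k) :=
          boaPotential_add_le hprior.1 hr
      _ = boaPotential E T prior (boaCum E T prior θ g t) := by
          rw [add_eq_left]
          exact sum_boaMass_mul_dotProduct hE hgrid hprior _ _
      _ ≤ (rateIndices E T).card := ih

lemma learningRate_mul_sum_boaCum_le (hE : 0 < E) (hGE : 4 * G ≤ 3 * E)
    (hprior : prior ∈ stdSimplex ℝ (Fin K)) (hθ : ∀ k, θ k ∈ l1Ball d)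
    (hg : ∀ t, ∀ v ∈ l1Ball d, ‖g (t + 1) v‖ ≤ G) {π : Fin K → ℝ}
    (hπ : π ∈ stdSimplex ℝ (Fin K)) (hac : ∀ k, prior k = 0 → π k = 0) {i : ℕ}
    (hi : i ∈ rateIndices E T) (t : ℕ) :
    learningRate E i * ∑ k, π k * boaCum E T prior θ g t (learningRate E i) k ≤
      klFin π prior + Real.log (rateIndices E T).card := by
  set η := learningRate E i
  have hmoment : ∑ k, prior k * Real.exp (η * boaCum E T prior θ g t η k) ≤
      (rateIndices E T).card :=
    (Finset.single_le_sum (f := fun i => ∑ k, prior k * Real.exp (learningRate E i *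
      boaCum E T prior θ g t (learningRate E i) k)) (fun _ _ => Finset.sum_nonneg fun k _ =>
      mul_nonneg (hprior.1 k) (Real.exp_pos _).le) hi).trans
      (boaPotential_boaCum_le hE hGE ⟨i, hi⟩ hprior hθ hg t)
  calc η * ∑ k, π k * boaCum E T prior θ g t η k
      = ∑ k, π k * (η * boaCum E T prior θ g t η k) := by
        rw [Finset.mul_sum]
        exact Finset.sum_congr rfl fun k _ => by ring
    _ ≤ klFin π prior + Real.log (rateIndices E T).card :=
        sum_mul_le_klFin_add_log hπ hprior.1 hac hmoment

end Deterministic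

/-! ### Moving a point of the ball, when subgradients are discontinuous -/

section Subgradient

variable {d : ℕ} {f : (Fin d → ℝ) → ℝ} {g : (Fin d → ℝ) → Fin d → ℝ} {u v w : Fin d → ℝ} {G : ℝ}

/-- The gap `f u - (f v + g(v)ᵀ(u - v))` between `f` and its linearization at `v`, written as the
linearized regret minus the regret `f v - f u`. Weak exp-concavity bounds it from below. -/
noncomputable def linGap (f : (Fin d → ℝ) → ℝ) (g : (Fin d → ℝ) → Fin d → ℝ) (v u : Fin d → ℝ) :
    ℝ :=
  linRegret g v u - (f v - f u)

lemma linRegret_swap (v u : Fin d → ℝ) : linRegret g v u = -(g v ⬝ᵥ (u - v)) := by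
  rw [linRegret, ← dotProduct_neg, neg_sub]

lemma linGap_nonneg (hv : IsSubgradientAt f (g v) v) : 0 ≤ linGap f g v u := by
  have h := hv u
  rw [linGap, linRegret_swap]
  linarith

lemma dotProduct_sub_nonneg (hv : IsSubgradientAt f (g v) v) (hw : IsSubgradientAt f (g w) w) :
    0 ≤ (g w - g v) ⬝ᵥ (w - v) := by
  have hvw := linGap_nonneg (u := w) hv
  have hwv := linGap_nonneg (u := v) hw
  rw [linGap, linRegret_swap] at hvw
  rw [linGap, linRegret] at hwv
  rw [sub_dotProduct]
  linarith

lemma abs_sub_le_mul_norm (hv : IsSubgradientAt f (g v) v) (hw : IsSubgradientAt f (g w) w)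
    (hgv : ‖g v‖ ≤ G) (hgw : ‖g w‖ ≤ G) : |f w - f v| ≤ G * ‖WithLp.toLp 1 (w - v)‖ := by
  have hvw := linGap_nonneg (u := w) hv
  have hwv := linGap_nonneg (u := v) hw
  rw [linGap, linRegret_swap] at hvw
  rw [linGap, linRegret] at hwv
  have hdv := (abs_dotProduct_le (g v) (w - v)).trans
    (mul_le_mul_of_nonneg_right hgv (norm_nonneg _))
  have hdw := (abs_dotProduct_le (g w) (w - v)).trans
    (mul_le_mul_of_nonneg_right hgw (norm_nonneg _))
  rw [abs_le] at *
  constructor <;> linarith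

variable {ε : ℝ}

lemma norm_toLp_sub_le_of_near (hv : v ∈ l1Ball d) (hu : u ∈ l1Ball d) (hε : 0 ≤ ε) (hε1 : ε ≤ 1)
    (hnear : ‖WithLp.toLp 1 (w - ((1 - ε) • v + ε • u))‖ ≤ ε ^ 2) :
    ‖WithLp.toLp 1 (w - v)‖ ≤ 3 * ε := by
  set e := w - ((1 - ε) • v + ε • u) with he
  have hdiff : w - v = e - ε • (v - u) := by rw [he]; module
  calc ‖WithLp.toLp 1 (w - v)‖ = ‖WithLp.toLp 1 e - ε • WithLp.toLp 1 (v - u)‖ := by rw [hdiff]; rfl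
    _ ≤ ‖WithLp.toLp 1 e‖ + ‖ε • WithLp.toLp 1 (v - u)‖ := norm_sub_le _ _
    _ = ‖WithLp.toLp 1 e‖ + ε * ‖WithLp.toLp 1 (v - u)‖ := by
        rw [norm_smul, Real.norm_of_nonneg hε]
    _ ≤ 3 * ε := by nlinarith [norm_toLp_sub_le_two hv hu]

/-- The point `w` is `v` moved by the fraction `ε` of the way towards `u`, up to an error `ε ^ 2`.
By monotonicity of subgradients, the component of the subgradient along `v - u` hardly increases,
although the subgradient itself may jump. -/
lemma linRegret_le_of_near (hv : v ∈ l1Ball d) (hu : u ∈ l1Ball d)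
    (hgv : IsSubgradientAt f (g v) v) (hgw : IsSubgradientAt f (g w) w)
    (hGv : ‖g v‖ ≤ G) (hGw : ‖g w‖ ≤ G) (hε : 0 < ε) (hε1 : ε ≤ 1)
    (hnear : ‖WithLp.toLp 1 (w - ((1 - ε) • v + ε • u))‖ ≤ ε ^ 2) :
    linRegret g w u ≤ linRegret g v u + 5 * G * ε := by
  have hG : 0 ≤ G := (norm_nonneg _).trans hGv
  set e := w - ((1 - ε) • v + ε • u) with he
  have hmono : ε * ((g w - g v) ⬝ᵥ (v - u)) ≤ (g w - g v) ⬝ᵥ e := by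
    have h := dotProduct_sub_nonneg hgv hgw
    rw [show w - v = e - ε • (v - u) by rw [he]; module, dotProduct_sub, dotProduct_smul,
      smul_eq_mul] at h
    linarith
  have herror : (g w - g v) ⬝ᵥ e ≤ 2 * G * ε ^ 2 :=
    calc (g w - g v) ⬝ᵥ e ≤ ‖g w - g v‖ * ‖WithLp.toLp 1 e‖ :=
          (le_abs_self _).trans (abs_dotProduct_le _ _)
      _ ≤ 2 * G * ε ^ 2 := mul_le_mul ((norm_sub_le _ _).trans (by linarith)) hnear
          (norm_nonneg _) (by linarith)
  have hdirection : (g w - g v) ⬝ᵥ (v - u) ≤ 2 * G * ε :=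
    le_of_mul_le_mul_left (by linarith) hε
  have hmove : g w ⬝ᵥ (w - v) ≤ 3 * G * ε :=
    calc g w ⬝ᵥ (w - v) ≤ ‖g w‖ * ‖WithLp.toLp 1 (w - v)‖ :=
          (le_abs_self _).trans (abs_dotProduct_le _ _)
      _ ≤ G * (3 * ε) := mul_le_mul hGw (norm_toLp_sub_le_of_near hv hu hε.le hε1 hnear)
          (norm_nonneg _) hG
      _ = 3 * G * ε := by ring
  calc linRegret g w u
      = g w ⬝ᵥ (w - v) + ((g w - g v) ⬝ᵥ (v - u) + linRegret g v u) := by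
        simp only [linRegret, sub_dotProduct, dotProduct_sub]
        ring
    _ ≤ linRegret g v u + 5 * G * ε := by linarith

/-- The multiplier of the gap grows by `4 * G` because the squared linearized regret is bounded at
the moved point `w`, where the linearized regret is smaller in general: with `|r|, |r'| ≤ 2 * G`,
`r ^ 2 - r' ^ 2` is at most `4 * G * (r - r')` once `r'` does not exceed `r`. -/
lemma sq_linRegret_sub_le_of_near (hv : v ∈ l1Ball d) (hw : w ∈ l1Ball d) (hu : u ∈ l1Ball d)
    (hgv : IsSubgradientAt f (g v) v) (hgw : IsSubgradientAt f (g w) w)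
    (hGv : ‖g v‖ ≤ G) (hGw : ‖g w‖ ≤ G) {κ : ℝ} (hκ : 0 ≤ κ) (hε : 0 < ε) (hε1 : ε ≤ 1)
    (hnear : ‖WithLp.toLp 1 (w - ((1 - ε) • v + ε • u))‖ ≤ ε ^ 2) :
    linRegret g v u ^ 2 - (κ + 4 * G) * linGap f g v u ≤
      linRegret g w u ^ 2 - κ * linGap f g w u + (52 * G ^ 2 + 8 * κ * G) * ε := by
  have hG : 0 ≤ G := (norm_nonneg _).trans hGv
  have hloss : |f w - f v| ≤ 3 * G * ε :=
    (abs_sub_le_mul_norm hgv hgw hGv hGw).trans (by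
      nlinarith [norm_toLp_sub_le_of_near hv hu hε.le hε1 hnear])
  have hregret := linRegret_le_of_near hv hu hgv hgw hGv hGw hε hε1 hnear
  have hrv := abs_le.mp (abs_linRegret_le hGv hv hu)
  have hrw := abs_le.mp (abs_linRegret_le hGw hw hu)
  have hgap := linGap_nonneg (u := u) hgw
  rw [abs_le] at hloss
  unfold linGap at hgap ⊢
  set r := linRegret g v u
  set r' := linRegret g w u
  have hsq : r ^ 2 - r' ^ 2 ≤ 4 * G * (r - r') + 40 * G ^ 2 * ε := by
    have h1 : (r - r' + 5 * G * ε) * (r + r') ≤ (r - r' + 5 * G * ε) * (4 * G) :=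
      mul_le_mul_of_nonneg_left (by linarith) (by linarith)
    have h2 : 0 ≤ 5 * G * ε * (4 * G + (r + r')) := mul_nonneg (by positivity) (by linarith)
    linarith
  have hκgap : κ * ((r' - (f w - f u)) - (r - (f v - f u))) ≤ κ * (8 * G * ε) :=
    mul_le_mul_of_nonneg_left (by linarith) hκ
  have hGgap : 4 * G * ((f v - f u) - r') ≤ 4 * G * (3 * G * ε) :=
    mul_le_mul_of_nonneg_left (by linarith) (by linarith)
  linarith

end Subgradient

/-! ### Conditional expectations at a random point -/

section RandomPoint

variable {Ω V : Type*} {m mΩ : MeasurableSpace Ω} {μ : Measure Ω} [MeasurableSpace V]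

lemma condExp_comp_le [MeasurableSingletonClass V] {F : Ω → V → ℝ} {X : Ω → V} {b : ℝ}
    (hX : Measurable[m] X) (hcount : (Set.range X).Countable)
    (hint : Integrable (fun ω => F ω (X ω)) μ)
    (hF : ∀ v ∈ Set.range X, Integrable (fun ω => F ω v) μ)
    (hle : ∀ v ∈ Set.range X, μ[fun ω => F ω v | m] ≤ᵐ[μ] fun _ => b) :
    μ[fun ω => F ω (X ω) | m] ≤ᵐ[μ] fun _ => b := by
  have hfiber : ∀ᵐ ω ∂μ, ∀ v ∈ Set.range X, X ω = v → (μ[fun ω' => F ω' (X ω') | m]) ω ≤ b := by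
    rw [ae_ball_iff hcount]
    intro v hv
    have hA : MeasurableSet[m] (X ⁻¹' {v}) := hX (measurableSet_singleton v)
    have heq : (X ⁻¹' {v}).indicator (fun ω => F ω (X ω)) =
        (X ⁻¹' {v}).indicator (fun ω => F ω v) :=
      Set.indicator_congr fun ω (hω : X ω = v) => by simp only [hω]
    have hrandom := condExp_indicator (m := m) hint hA
    rw [heq] at hrandom
    filter_upwards [hrandom, condExp_indicator (m := m) (hF v hv) hA, hle v hv]
      with ω hrandom hfixed hle (hω : ω ∈ X ⁻¹' {v})
    rw [Set.indicator_of_mem hω] at hrandom hfixed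
    rwa [← hrandom, hfixed]
  filter_upwards [hfiber] with ω h using h (X ω) ⟨ω, rfl⟩ rfl

lemma exists_measurable_countable_range_dist_lt [PseudoMetricSpace V] [OpensMeasurableSpace V]
    {s : Set V} (hs : TopologicalSpace.IsSeparable s) {Z : Ω → V} (hZ : Measurable Z)
    (hZs : ∀ ω, Z ω ∈ s) {ε : ℝ} (hε : 0 < ε) :
    ∃ X : Ω → V, Measurable X ∧ (Set.range X).Countable ∧ ∀ ω, X ω ∈ s ∧ dist (X ω) (Z ω) < ε := by
  classical
  cases isEmpty_or_nonempty Ω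
  · exact ⟨Z, hZ, Set.countable_range Z, isEmptyElim⟩
  obtain ⟨c, hcs, hc, hdense⟩ := hs.exists_countable_dense_subset
  have hne : c.Nonempty :=
    closure_nonempty_iff.mp ⟨_, hdense (hZs (Classical.arbitrary Ω))⟩
  obtain ⟨f, rfl⟩ := hc.exists_eq_range hne
  have hnear (ω : Ω) : ∃ n, dist (f n) (Z ω) < ε := by
    obtain ⟨_, ⟨n, rfl⟩, h⟩ := Metric.mem_closure_iff.mp (hdense (hZs ω)) ε hε
    exact ⟨n, dist_comm (Z ω) _ ▸ h⟩
  refine ⟨fun ω => f (Nat.find (hnear ω)), ?_, ?_, fun ω => ⟨hcs ⟨_, rfl⟩, Nat.find_spec (hnear ω)⟩⟩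
  · refine Measurable.find (fun _ => measurable_const) (fun n => ?_) hnear
    exact hZ (isOpen_lt (continuous_const.dist continuous_id) continuous_const).measurableSet
  · exact (Set.countable_range f).mono (by rintro _ ⟨ω, rfl⟩; exact ⟨_, rfl⟩)

lemma exists_measurable_countable_range_near {d : ℕ} {Z : Ω → Fin d → ℝ} (hZ : Measurable Z)
    (hZB : ∀ ω, Z ω ∈ l1Ball d) {ε : ℝ} (hε : 0 < ε) :
    ∃ X : Ω → Fin d → ℝ, Measurable X ∧ (Set.range X).Countable ∧
      ∀ ω, X ω ∈ l1Ball d ∧ ‖WithLp.toLp 1 (X ω - Z ω)‖ ≤ ε := by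
  obtain ⟨Y, hY, hcount, hYZ⟩ := exists_measurable_countable_range_dist_lt
    (TopologicalSpace.IsSeparable.of_separableSpace (Metric.closedBall (0 : PiLp 1 fun _ => ℝ) 1))
    ((WithLp.measurable_toLp 1 _).comp hZ) (fun ω => mem_l1Ball_iff.mp (hZB ω)) hε
  refine ⟨fun ω => WithLp.ofLp (Y ω), (WithLp.measurable_ofLp 1 _).comp hY, ?_, fun ω =>
    ⟨mem_l1Ball_iff.mpr (hYZ ω).1, ?_⟩⟩
  · exact Set.range_comp WithLp.ofLp Y ▸ hcount.image _
  · exact (dist_eq_norm (Y ω) (WithLp.toLp 1 (Z ω))) ▸ (hYZ ω).2.le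

lemma condExp_le_const (hm : m ≤ mΩ) [IsFiniteMeasure μ] {f : Ω → ℝ} {b : ℝ} (hf : Integrable f μ)
    (hfb : f ≤ᵐ[μ] fun _ => b) : μ[f | m] ≤ᵐ[μ] fun _ => b :=
  (condExp_mono hf (integrable_const b) hfb).trans_eq (condExp_const hm b).eventuallyEq

end RandomPoint

/-! ### The losses of one round -/

section Measurability

variable {Ω : Type*} {m : MeasurableSpace Ω} {d : ℕ}

lemma measurable_linRegret {g : Ω → (Fin d → ℝ) → Fin d → ℝ} {X : Ω → Fin d → ℝ}
    (hg : Measurable fun p : Ω × (Fin d → ℝ) => g p.1 p.2) (hX : Measurable X) (u : Fin d → ℝ) :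
    Measurable fun ω => linRegret (g ω) (X ω) u := by
  have hgX : Measurable fun ω => g ω (X ω) := hg.comp (measurable_id.prodMk hX)
  simp only [linRegret, dotProduct]
  fun_prop

lemma measurable_convex_comp {f : Ω → (Fin d → ℝ) → ℝ} (hconv : ∀ ω, ConvexOn ℝ Set.univ (f ω))
    (hf : ∀ v, Measurable fun ω => f ω v) {X : Ω → Fin d → ℝ} (hX : Measurable X) :
    Measurable fun ω => f ω (X ω) :=
  (measurable_uncurry_of_continuous_of_measurable (u := fun v ω => f ω v)
    (fun ω => (hconv ω).locallyLipschitz.continuous) hf).comp (hX.prodMk measurable_id)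

end Measurability

section OneRound

variable {Ω : Type*} {mΩ : MeasurableSpace Ω} {μ : Measure Ω} {ℱ : Filtration ℕ mΩ} {d : ℕ}
  {ℓ : ℕ → Ω → (Fin d → ℝ) → ℝ} {grad : ℕ → Ω → (Fin d → ℝ) → (Fin d → ℝ)} {G α β c : ℝ}
  {u : Fin d → ℝ} {X : Ω → Fin d → ℝ} {t : ℕ}

lemma LipschitzLoss.ae_forall_norm_le (hlip : LipschitzLoss μ grad G) :
    ∀ᵐ ω ∂μ, ∀ t, ∀ v ∈ l1Ball d, ‖grad (t + 1) ω v‖ ≤ G :=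
  ae_all_iff.mpr fun t => hlip (t + 1) t.succ_pos

lemma LipschitzLoss.ae_abs_linRegret_le (hlip : LipschitzLoss μ grad G)
    (hX : ∀ ω, X ω ∈ l1Ball d) (hu : u ∈ l1Ball d) :
    ∀ᵐ ω ∂μ, |linRegret (grad (t + 1) ω) (X ω) u| ≤ 2 * G := by
  filter_upwards [hlip.ae_forall_norm_le] with ω h
  exact abs_linRegret_le (h t _ (hX ω)) (hX ω) hu

lemma LipschitzLoss.ae_sq_linRegret_le (hlip : LipschitzLoss μ grad G)
    (hX : ∀ ω, X ω ∈ l1Ball d) (hu : u ∈ l1Ball d) :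
    ∀ᵐ ω ∂μ, linRegret (grad (t + 1) ω) (X ω) u ^ 2 ≤ 4 * G ^ 2 := by
  filter_upwards [hlip.ae_forall_norm_le] with ω h
  exact sq_linRegret_le (h t _ (hX ω)) (hX ω) hu

namespace IsLossSequence

lemma measurable_linRegret_adapted (hloss : IsLossSequence μ ℱ ℓ grad)
    (hX : Measurable[ℱ (t + 1)] X) (u : Fin d → ℝ) :
    Measurable[ℱ (t + 1)] fun ω => linRegret (grad (t + 1) ω) (X ω) u :=
  measurable_linRegret (hloss.measurable_grad (t + 1) t.succ_pos) hX u

lemma measurable_linRegret_comp (hloss : IsLossSequence μ ℱ ℓ grad) (hX : Measurable X)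
    (u : Fin d → ℝ) : Measurable fun ω => linRegret (grad (t + 1) ω) (X ω) u := by
  refine measurable_linRegret ((hloss.measurable_grad (t + 1) t.succ_pos).mono ?_ le_rfl) hX u
  exact sup_le_sup (MeasurableSpace.comap_mono (ℱ.le _)) le_rfl

lemma isSubgradientAt (hloss : IsLossSequence μ ℱ ℓ grad) (t : ℕ) (ω : Ω) {v : Fin d → ℝ}
    (hv : v ∈ l1Ball d) : IsSubgradientAt (ℓ (t + 1) ω) (grad (t + 1) ω v) v :=
  hloss.subgradient (t + 1) t.succ_pos ω v hv

lemma integrable_loss_succ (hloss : IsLossSequence μ ℱ ℓ grad) (hu : u ∈ l1Ball d) :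
    Integrable (fun ω => ℓ (t + 1) ω u) μ :=
  hloss.integrable_loss (t + 1) t.succ_pos u hu

variable [IsFiniteMeasure μ]

lemma integrable_linRegret (hloss : IsLossSequence μ ℱ ℓ grad) (hlip : LipschitzLoss μ grad G)
    (hXm : Measurable X) (hX : ∀ ω, X ω ∈ l1Ball d) (hu : u ∈ l1Ball d) :
    Integrable (fun ω => linRegret (grad (t + 1) ω) (X ω) u) μ :=
  .of_bound (hloss.measurable_linRegret_comp hXm u).aestronglyMeasurable (2 * G)
    (hlip.ae_abs_linRegret_le hX hu)

lemma integrable_sq_linRegret (hloss : IsLossSequence μ ℱ ℓ grad) (hlip : LipschitzLoss μ grad G)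
    (hXm : Measurable X) (hX : ∀ ω, X ω ∈ l1Ball d) (hu : u ∈ l1Ball d) :
    Integrable (fun ω => linRegret (grad (t + 1) ω) (X ω) u ^ 2) μ := by
  refine .of_bound ((hloss.measurable_linRegret_comp hXm u).pow_const 2).aestronglyMeasurable
    (4 * G ^ 2) ?_
  simpa only [Real.norm_of_nonneg (sq_nonneg _)] using hlip.ae_sq_linRegret_le hX hu

lemma integrable_loss_comp (hloss : IsLossSequence μ ℱ ℓ grad) (hlip : LipschitzLoss μ grad G)
    (hXm : Measurable X) (hX : ∀ ω, X ω ∈ l1Ball d) :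
    Integrable (fun ω => ℓ (t + 1) ω (X ω)) μ := by
  have h0 := zero_mem_l1Ball (d := d)
  have hmeas (v : Fin d → ℝ) : Measurable fun ω => ℓ (t + 1) ω v :=
    (hloss.measurable_loss (t + 1) t.succ_pos v).mono (ℱ.le _) le_rfl
  have hdiff : Integrable (fun ω => ℓ (t + 1) ω (X ω) - ℓ (t + 1) ω 0) μ := by
    refine .of_bound ((measurable_convex_comp (hloss.convex (t + 1) t.succ_pos) hmeas hXm).sub
      (hmeas 0)).aestronglyMeasurable (G * 2) ?_
    filter_upwards [hlip.ae_forall_norm_le] with ω h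
    calc |ℓ (t + 1) ω (X ω) - ℓ (t + 1) ω 0| ≤ G * ‖WithLp.toLp 1 (X ω - 0)‖ :=
          abs_sub_le_mul_norm (hloss.isSubgradientAt t ω h0) (hloss.isSubgradientAt t ω (hX ω))
            (h t 0 h0) (h t _ (hX ω))
      _ ≤ G * 2 := mul_le_mul_of_nonneg_left (norm_toLp_sub_le_two (hX ω) h0)
          ((norm_nonneg _).trans (h t 0 h0))
  exact (hdiff.add (hloss.integrable_loss_succ h0)).congr
    (ae_of_all _ fun ω => sub_add_cancel (ℓ (t + 1) ω (X ω)) (ℓ (t + 1) ω 0))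

lemma integrable_linGap (hloss : IsLossSequence μ ℱ ℓ grad) (hlip : LipschitzLoss μ grad G)
    (hXm : Measurable X) (hX : ∀ ω, X ω ∈ l1Ball d) (hu : u ∈ l1Ball d) :
    Integrable (fun ω => linGap (ℓ (t + 1) ω) (grad (t + 1) ω) (X ω) u) μ :=
  (hloss.integrable_linRegret hlip hXm hX hu).sub
    ((hloss.integrable_loss_comp hlip hXm hX).sub (hloss.integrable_loss_succ hu))

lemma condExp_linGap (hloss : IsLossSequence μ ℱ ℓ grad) (hlip : LipschitzLoss μ grad G)
    (hXm : Measurable X) (hX : ∀ ω, X ω ∈ l1Ball d) (hu : u ∈ l1Ball d) :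
    μ[fun ω => linGap (ℓ (t + 1) ω) (grad (t + 1) ω) (X ω) u | ℱ t] =ᵐ[μ]
      μ[fun ω => linRegret (grad (t + 1) ω) (X ω) u | ℱ t] -
        (μ[fun ω => ℓ (t + 1) ω (X ω) | ℱ t] - μ[fun ω => ℓ (t + 1) ω u | ℱ t]) := by
  have hX' := hloss.integrable_loss_comp (t := t) hlip hXm hX
  have hu' := hloss.integrable_loss_succ (t := t) hu
  filter_upwards [condExp_sub (hloss.integrable_linRegret hlip hXm hX hu) (hX'.sub hu') (ℱ t),
    condExp_sub hX' hu' (ℱ t)] with ω hgap hdiff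
  exact hgap.trans (congrArg ((μ[fun ω => linRegret (grad (t + 1) ω) (X ω) u | ℱ t]) ω - ·) hdiff)

lemma integrable_invPow (hloss : IsLossSequence μ ℱ ℓ grad) (hlip : LipschitzLoss μ grad G)
    (hα : 0 ≤ α) (hβ : 0 ≤ β) {v : Fin d → ℝ} (hv : v ∈ l1Ball d) (hu : u ∈ l1Ball d) :
    Integrable (fun ω => invPow (α * linRegret (grad (t + 1) ω) v u ^ 2) β) μ := by
  have hmeas := hloss.measurable_linRegret_comp (t := t) (measurable_const (a := v)) u
  refine .of_bound ((measurable_invPow β).comp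
    ((hmeas.pow_const 2).const_mul α)).aestronglyMeasurable (invPow (α * (4 * G ^ 2)) β) ?_
  filter_upwards [hlip.ae_sq_linRegret_le (t := t) (X := fun _ => v) (fun _ => hv) hu] with ω h
  have hnonneg : 0 ≤ α * linRegret (grad (t + 1) ω) v u ^ 2 := by positivity
  rw [Real.norm_of_nonneg (invPow_nonneg hnonneg β)]
  exact invPow_le_invPow hnonneg (mul_le_mul_of_nonneg_left h hα) hβ

end IsLossSequence

lemma WeakExpConcave.condExp_invPow_le [IsFiniteMeasure μ]
    (hexp : WeakExpConcave μ ℱ ℓ grad α β) (hloss : IsLossSequence μ ℱ ℓ grad)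
    (hlip : LipschitzLoss μ grad G) {v : Fin d → ℝ} (hv : v ∈ l1Ball d) (hu : u ∈ l1Ball d) :
    μ[fun ω => invPow (α * linRegret (grad (t + 1) ω) v u ^ 2) β | ℱ t] ≤ᵐ[μ]
      μ[fun ω => linGap (ℓ (t + 1) ω) (grad (t + 1) ω) v u | ℱ t] := by
  have hgap := hloss.condExp_linGap (t := t) hlip (measurable_const (a := v)) (fun _ => hv) hu
  filter_upwards [(hexp (t + 1) t.succ_pos v hv u hu).2, hgap,
    condExp_sub (hloss.integrable_loss_succ (t := t) hv) (hloss.integrable_loss_succ hu) (ℱ t)]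
    with ω hexp hgap hdiff
  rw [hgap, Pi.sub_apply]
  have hexp' := hdiff.symm.trans_le hexp
  rw [Nat.add_sub_cancel] at hexp'
  exact le_sub_comm.mp hexp'

lemma WeakExpConcave.ae_sq_linRegret_le_invPow (hexp : WeakExpConcave μ ℱ ℓ grad α β)
    (hα : 0 < α) (hβ : 0 ≤ β) (hβ1 : β ≤ 1) (hc : 0 < c) {v : Fin d → ℝ} (hv : v ∈ l1Ball d)
    (hu : u ∈ l1Ball d) :
    ∀ᵐ ω ∂μ, linRegret (grad (t + 1) ω) v u ^ 2 ≤
      c ^ (β - 1) / α * invPow (α * linRegret (grad (t + 1) ω) v u ^ 2) β + c ^ β / α := by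
  have hzero : ∀ᵐ ω ∂μ, β = 0 → α * linRegret (grad (t + 1) ω) v u ^ 2 ≤ 1 :=
    Filter.eventually_imp_distrib_left.mpr (hexp (t + 1) t.succ_pos v hv u hu).1
  filter_upwards [hzero] with ω h
  have hle := le_mul_invPow_add (by positivity) hβ hβ1 hc h
  rw [div_mul_eq_mul_div, ← add_div, le_div_iff₀ hα]
  linarith

variable [IsFiniteMeasure μ]

lemma IsLossSequence.integrable_sq_linRegret_sub (hloss : IsLossSequence μ ℱ ℓ grad)
    (hlip : LipschitzLoss μ grad G) (hXm : Measurable X) (hX : ∀ ω, X ω ∈ l1Ball d)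
    (hu : u ∈ l1Ball d) (κ : ℝ) :
    Integrable (fun ω => linRegret (grad (t + 1) ω) (X ω) u ^ 2 -
      κ * linGap (ℓ (t + 1) ω) (grad (t + 1) ω) (X ω) u) μ :=
  (hloss.integrable_sq_linRegret hlip hXm hX hu).sub
    ((hloss.integrable_linGap hlip hXm hX hu).const_mul κ)

lemma IsLossSequence.condExp_sq_linRegret_sub (hloss : IsLossSequence μ ℱ ℓ grad)
    (hlip : LipschitzLoss μ grad G) (hXm : Measurable X) (hX : ∀ ω, X ω ∈ l1Ball d)
    (hu : u ∈ l1Ball d) (κ : ℝ) :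
    μ[fun ω => linRegret (grad (t + 1) ω) (X ω) u ^ 2 -
        κ * linGap (ℓ (t + 1) ω) (grad (t + 1) ω) (X ω) u | ℱ t] =ᵐ[μ]
      μ[fun ω => linRegret (grad (t + 1) ω) (X ω) u ^ 2 | ℱ t] -
        κ • μ[fun ω => linGap (ℓ (t + 1) ω) (grad (t + 1) ω) (X ω) u | ℱ t] :=
  (condExp_sub (hloss.integrable_sq_linRegret hlip hXm hX hu)
    ((hloss.integrable_linGap hlip hXm hX hu).const_mul κ) (ℱ t)).trans
    ((Filter.EventuallyEq.refl _ _).sub (condExp_smul κ _ (ℱ t)))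

namespace WeakExpConcave

lemma condExp_sq_linRegret_sub_le_of_const (hexp : WeakExpConcave μ ℱ ℓ grad α β)
    (hloss : IsLossSequence μ ℱ ℓ grad) (hlip : LipschitzLoss μ grad G) (hα : 0 < α)
    (hβ : 0 ≤ β) (hβ1 : β ≤ 1) (hc : 0 < c) {v : Fin d → ℝ} (hv : v ∈ l1Ball d)
    (hu : u ∈ l1Ball d) :
    μ[fun ω => linRegret (grad (t + 1) ω) v u ^ 2 -
      c ^ (β - 1) / α * linGap (ℓ (t + 1) ω) (grad (t + 1) ω) v u | ℱ t] ≤ᵐ[μ]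
        fun _ => c ^ β / α := by
  set κ := c ^ (β - 1) / α
  have hpow := hloss.integrable_invPow (t := t) hlip hα.le hβ hv hu
  have hmoment : μ[fun ω => linRegret (grad (t + 1) ω) v u ^ 2 | ℱ t] ≤ᵐ[μ]
      κ • μ[fun ω => invPow (α * linRegret (grad (t + 1) ω) v u ^ 2) β | ℱ t] +
        fun _ => c ^ β / α := by
    refine (condExp_mono (hloss.integrable_sq_linRegret hlip measurable_const (fun _ => hv) hu)
      ((hpow.const_mul κ).add (integrable_const _))
      (hexp.ae_sq_linRegret_le_invPow hα hβ hβ1 hc hv hu)).trans_eq ?_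
    exact (condExp_add (hpow.const_mul κ) (integrable_const _) (ℱ t)).trans
      ((condExp_smul κ _ (ℱ t)).add (condExp_const (ℱ.le t) _).eventuallyEq)
  filter_upwards [hmoment, hexp.condExp_invPow_le hloss hlip hv hu,
    hloss.condExp_sq_linRegret_sub hlip measurable_const (fun _ => hv) hu κ]
    with ω hmoment hgap hsub
  have hκ0 : 0 ≤ κ := by positivity
  simp only [Pi.add_apply, Pi.sub_apply, Pi.smul_apply, smul_eq_mul] at hmoment hsub
  rw [hsub]
  linarith [mul_le_mul_of_nonneg_left hgap hκ0]

lemma condExp_sq_linRegret_sub_le_add (hexp : WeakExpConcave μ ℱ ℓ grad α β)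
    (hloss : IsLossSequence μ ℱ ℓ grad) (hlip : LipschitzLoss μ grad G) (hα : 0 < α)
    (hβ : 0 ≤ β) (hβ1 : β ≤ 1) (hc : 0 < c) (hXm : Measurable[ℱ t] X)
    (hX : ∀ ω, X ω ∈ l1Ball d) (hu : u ∈ l1Ball d) {ε : ℝ} (hε : 0 < ε) (hε1 : ε ≤ 1) :
    μ[fun ω => linRegret (grad (t + 1) ω) (X ω) u ^ 2 -
      (c ^ (β - 1) / α + 4 * G) * linGap (ℓ (t + 1) ω) (grad (t + 1) ω) (X ω) u | ℱ t] ≤ᵐ[μ]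
        fun _ => c ^ β / α + (52 * G ^ 2 + 8 * (c ^ (β - 1) / α) * G) * ε := by
  set κ := c ^ (β - 1) / α
  have hmoved (ω : Ω) : (1 - ε) • X ω + ε • u ∈ l1Ball d :=
    convex_l1Ball (hX ω) hu (by linarith) hε.le (by ring)
  obtain ⟨Y, hYm, hYc, hY⟩ := exists_measurable_countable_range_near
    ((hXm.const_smul (1 - ε)).add_const (ε • u)) hmoved (pow_pos hε 2)
  have hYm' : Measurable Y := hYm.mono (ℱ.le t) le_rfl
  have hYint := hloss.integrable_sq_linRegret_sub (t := t) hlip hYm' (fun ω => (hY ω).1) hu κ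
  have hYle : μ[fun ω => linRegret (grad (t + 1) ω) (Y ω) u ^ 2 -
      κ * linGap (ℓ (t + 1) ω) (grad (t + 1) ω) (Y ω) u | ℱ t] ≤ᵐ[μ] fun _ => c ^ β / α := by
    refine condExp_comp_le (F := fun ω v => linRegret (grad (t + 1) ω) v u ^ 2 -
      κ * linGap (ℓ (t + 1) ω) (grad (t + 1) ω) v u) hYm hYc hYint ?_ ?_
    · rintro _ ⟨ω, rfl⟩
      exact hloss.integrable_sq_linRegret_sub hlip measurable_const (fun _ => (hY ω).1) hu κ
    · rintro _ ⟨ω, rfl⟩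
      exact hexp.condExp_sq_linRegret_sub_le_of_const hloss hlip hα hβ hβ1 hc (hY ω).1 hu
  have hXY : μ[fun ω => linRegret (grad (t + 1) ω) (X ω) u ^ 2 -
      (κ + 4 * G) * linGap (ℓ (t + 1) ω) (grad (t + 1) ω) (X ω) u | ℱ t] ≤ᵐ[μ]
      μ[fun ω => linRegret (grad (t + 1) ω) (Y ω) u ^ 2 -
        κ * linGap (ℓ (t + 1) ω) (grad (t + 1) ω) (Y ω) u | ℱ t] +
        fun _ => (52 * G ^ 2 + 8 * κ * G) * ε := by
    refine (condExp_mono (hloss.integrable_sq_linRegret_sub hlip (hXm.mono (ℱ.le t) le_rfl) hX hu _)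
      (hYint.add (integrable_const _)) ?_).trans_eq ((condExp_add hYint (integrable_const _)
        (ℱ t)).trans ((Filter.EventuallyEq.refl _ _).add (condExp_const (ℱ.le t) _).eventuallyEq))
    filter_upwards [hlip.ae_forall_norm_le] with ω h
    exact sq_linRegret_sub_le_of_near (hX ω) (hY ω).1 hu (hloss.isSubgradientAt t ω (hX ω))
      (hloss.isSubgradientAt t ω (hY ω).1) (h t _ (hX ω)) (h t _ (hY ω).1) (by positivity) hε hε1
      (hY ω).2
  filter_upwards [hYle, hXY] with ω hYle hXY
  exact hXY.trans (add_le_add_left hYle _)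

lemma condExp_sq_linRegret_sub_le (hexp : WeakExpConcave μ ℱ ℓ grad α β)
    (hloss : IsLossSequence μ ℱ ℓ grad) (hlip : LipschitzLoss μ grad G) (hα : 0 < α)
    (hβ : 0 ≤ β) (hβ1 : β ≤ 1) (hc : 0 < c) (hXm : Measurable[ℱ t] X)
    (hX : ∀ ω, X ω ∈ l1Ball d) (hu : u ∈ l1Ball d) :
    μ[fun ω => linRegret (grad (t + 1) ω) (X ω) u ^ 2 -
      (c ^ (β - 1) / α + 4 * G) * linGap (ℓ (t + 1) ω) (grad (t + 1) ω) (X ω) u | ℱ t] ≤ᵐ[μ]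
        fun _ => c ^ β / α := by
  have happrox (n : ℕ) := hexp.condExp_sq_linRegret_sub_le_add hloss hlip hα hβ hβ1 hc hXm hX hu
    (Nat.one_div_pos_of_nat (n := n)) (div_le_self zero_le_one (by simp))
  filter_upwards [ae_all_iff.mpr happrox] with ω h
  refine ge_of_tendsto' (x := Filter.atTop) ?_ h
  simpa using (tendsto_one_div_add_atTop_nhds_zero_nat.const_mul
    (52 * G ^ 2 + 8 * (c ^ (β - 1) / α) * G)).const_add (c ^ β / α)

lemma ae_condExp_sq_linRegret_le (hexp : WeakExpConcave μ ℱ ℓ grad α β)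
    (hloss : IsLossSequence μ ℱ ℓ grad) (hlip : LipschitzLoss μ grad G) (hα : 0 < α)
    (hβ : 0 ≤ β) (hβ1 : β ≤ 1) (hXm : Measurable[ℱ t] X) (hX : ∀ ω, X ω ∈ l1Ball d)
    (hu : u ∈ l1Ball d) :
    ∀ᵐ ω ∂μ, ∀ c : ℝ, 0 < c → (μ[fun ω => linRegret (grad (t + 1) ω) (X ω) u ^ 2 | ℱ t]) ω ≤
      (c ^ (β - 1) / α + 4 * G) *
        (μ[fun ω => linGap (ℓ (t + 1) ω) (grad (t + 1) ω) (X ω) u | ℱ t]) ω + c ^ β / α := by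
  have hrat : ∀ᵐ ω ∂μ, ∀ q : ℚ, 0 < (q : ℝ) →
      (μ[fun ω => linRegret (grad (t + 1) ω) (X ω) u ^ 2 | ℱ t]) ω ≤
        ((q : ℝ) ^ (β - 1) / α + 4 * G) *
          (μ[fun ω => linGap (ℓ (t + 1) ω) (grad (t + 1) ω) (X ω) u | ℱ t]) ω +
          (q : ℝ) ^ β / α := by
    refine ae_all_iff.mpr fun q => Filter.eventually_imp_distrib_left.mpr fun hq => ?_
    filter_upwards [hexp.condExp_sq_linRegret_sub_le hloss hlip hα hβ hβ1 hq hXm hX hu,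
      hloss.condExp_sq_linRegret_sub hlip (hXm.mono (ℱ.le t) le_rfl) hX hu _] with ω hle hsub
    rw [hsub, Pi.sub_apply, Pi.smul_apply, smul_eq_mul] at hle
    linarith
  filter_upwards [hrat] with ω h c hc
  obtain ⟨q, -, hqc, hq⟩ := Real.exists_seq_rat_strictAnti_tendsto c
  have hpow (s : ℝ) : Filter.Tendsto (fun n => (q n : ℝ) ^ s) .atTop (nhds (c ^ s)) :=
    hq.rpow_const (.inl hc.ne')
  exact ge_of_tendsto' ((((hpow _).div_const α).add_const _ |>.mul_const _).add
    ((hpow _).div_const α)) fun n => h (q n) (hc.trans (hqc n))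

end WeakExpConcave

end OneRound

/-! ### Exponential supermartingales -/

section Supermartingale

variable {Ω : Type*} {m mΩ : MeasurableSpace Ω} {μ : Measure Ω} {ℱ : Filtration ℕ mΩ}
  {y : Ω → ℝ} {ξ : ℕ → Ω → ℝ} {c : ℝ}

/-- The exponent `E[y | m] - 4 E[y² | m] - y + y²`: the exponential of `-y + y²`, compensated by an
upper bound on its conditional expectation when `y` is small. -/
noncomputable def compensatedExponent (μ : Measure Ω) (m : MeasurableSpace Ω) (y : Ω → ℝ) (ω : Ω) :
    ℝ :=
  ((μ[y | m]) ω - 4 * (μ[fun ω' => y ω' ^ 2 | m]) ω) + (-y ω + y ω ^ 2)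

lemma measurable_compensatedExponent {m' : MeasurableSpace Ω} (hm : m ≤ m')
    (hy : Measurable[m'] y) : Measurable[m'] (compensatedExponent μ m y) :=
  ((stronglyMeasurable_condExp.measurable.mono hm le_rfl).sub
    ((stronglyMeasurable_condExp.measurable.mono hm le_rfl).const_mul 4)).add
      (hy.neg.add (hy.pow_const 2))

variable [IsFiniteMeasure μ]

lemma integrable_exp_of_ae_le {f : Ω → ℝ} (hf : Measurable f) (hfc : ∀ᵐ ω ∂μ, f ω ≤ c) :
    Integrable (fun ω => Real.exp (f ω)) μ := by
  refine .of_bound (Real.measurable_exp.comp hf).aestronglyMeasurable (Real.exp c) ?_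
  simpa only [Real.norm_of_nonneg (Real.exp_pos _).le, Real.exp_le_exp] using hfc

lemma integrable_exp_sum (hξ : ∀ t, Measurable[ℱ (t + 1)] (ξ t)) (hξc : ∀ t, ∀ᵐ ω ∂μ, ξ t ω ≤ c)
    (n : ℕ) : Integrable (fun ω => Real.exp (∑ t ∈ Finset.range n, ξ t ω)) μ := by
  refine integrable_exp_of_ae_le (c := n * c)
    (Finset.measurable_sum _ fun t _ => (hξ t).mono (ℱ.le _) le_rfl) ?_
  filter_upwards [ae_all_iff.mpr hξc] with ω h
  simpa using Finset.sum_le_card_nsmul (Finset.range n) (fun t => ξ t ω) c fun t _ => h t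

lemma supermartingale_exp_sum (hξ : ∀ t, Measurable[ℱ (t + 1)] (ξ t))
    (hξc : ∀ t, ∀ᵐ ω ∂μ, ξ t ω ≤ c)
    (hcond : ∀ t, μ[fun ω => Real.exp (ξ t ω) | ℱ t] ≤ᵐ[μ] fun _ => 1) :
    Supermartingale (fun n ω => Real.exp (∑ t ∈ Finset.range n, ξ t ω)) ℱ μ := by
  have hmeas (n : ℕ) : StronglyMeasurable[ℱ n] fun ω => Real.exp (∑ t ∈ Finset.range n, ξ t ω) :=
    (Real.measurable_exp.comp (Finset.measurable_sum _ fun t ht =>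
      (hξ t).mono (ℱ.mono (Finset.mem_range.mp ht)) le_rfl)).stronglyMeasurable
  refine supermartingale_nat hmeas (integrable_exp_sum hξ hξc) fun n => ?_
  have hmul : (fun ω => Real.exp (∑ t ∈ Finset.range (n + 1), ξ t ω)) =
      (fun ω => Real.exp (∑ t ∈ Finset.range n, ξ t ω)) * fun ω => Real.exp (ξ n ω) := by
    ext ω
    rw [Finset.sum_range_succ, Real.exp_add, Pi.mul_apply]
  have hpull := condExp_mul_of_stronglyMeasurable_left (hmeas n)
    (hmul ▸ integrable_exp_sum hξ hξc (n + 1))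
    (integrable_exp_of_ae_le ((hξ n).mono (ℱ.le _) le_rfl) (hξc n))
  rw [hmul]
  filter_upwards [hpull, hcond n] with ω hpull hcond
  rw [hpull, Pi.mul_apply]
  exact mul_le_of_le_one_right (Real.exp_pos _).le hcond

lemma integrable_exp_neg_add_sq (hy : Measurable y) (hbd : ∀ᵐ ω ∂μ, |y ω| ≤ 3 / 5) :
    Integrable (fun ω => Real.exp (-y ω + y ω ^ 2)) μ := by
  refine integrable_exp_of_ae_le (c := 1) (hy.neg.add (hy.pow_const 2)) ?_
  filter_upwards [hbd] with ω h
  nlinarith [abs_le.mp h]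

lemma condExp_exp_neg_add_sq_le (hm : m ≤ mΩ) (hy : Measurable y)
    (hbd : ∀ᵐ ω ∂μ, |y ω| ≤ 3 / 5) :
    μ[fun ω => Real.exp (-y ω + y ω ^ 2) | m] ≤ᵐ[μ]
      fun ω => Real.exp (-((μ[y | m]) ω - 4 * (μ[fun ω' => y ω' ^ 2 | m]) ω)) := by
  have hyint : Integrable y μ := .of_bound hy.aestronglyMeasurable _ hbd
  have hsqint : Integrable (fun ω => 4 * y ω ^ 2) μ :=
    (hyint.mul_bdd hy.aestronglyMeasurable hbd).const_mul 4 |>.congr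
      (ae_of_all _ fun ω => by simp only [sq])
  have hlinint : Integrable ((fun _ => (1 : ℝ)) - y) μ := (integrable_const 1).sub hyint
  have hmono : μ[fun ω => Real.exp (-y ω + y ω ^ 2) | m] ≤ᵐ[μ]
      μ[((fun _ => (1 : ℝ)) - y) + fun ω => 4 * y ω ^ 2 | m] := by
    refine condExp_mono (integrable_exp_neg_add_sq hy hbd) (hlinint.add hsqint) ?_
    filter_upwards [hbd] with ω h using exp_neg_add_sq_le h
  filter_upwards [hmono, condExp_add hlinint hsqint m,
    condExp_sub (integrable_const (1 : ℝ)) hyint m,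
    condExp_smul (μ := μ) (4 : ℝ) (fun ω => y ω ^ 2) m] with ω hmono hadd hsub hsmul
  have hsmul' : (μ[fun ω => 4 * y ω ^ 2 | m]) ω = 4 * (μ[fun ω => y ω ^ 2 | m]) ω := hsmul
  calc (μ[fun ω => Real.exp (-y ω + y ω ^ 2) | m]) ω
      ≤ -((μ[y | m]) ω - 4 * (μ[fun ω => y ω ^ 2 | m]) ω) + 1 := by
        rw [hadd, Pi.add_apply, hsub, Pi.sub_apply, condExp_const hm, hsmul'] at hmono
        linarith
    _ ≤ _ := Real.add_one_le_exp _

lemma ae_compensatedExponent_le (hm : m ≤ mΩ) (hy : Measurable y)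
    (hbd : ∀ᵐ ω ∂μ, |y ω| ≤ 3 / 5) : ∀ᵐ ω ∂μ, compensatedExponent μ m y ω ≤ 2 := by
  have hmean : μ[y | m] ≤ᵐ[μ] fun _ => 3 / 5 :=
    condExp_le_const hm (.of_bound hy.aestronglyMeasurable _ hbd)
      (hbd.mono fun ω h => (abs_le.mp h).2)
  have hsq : 0 ≤ᵐ[μ] μ[fun ω => y ω ^ 2 | m] := condExp_nonneg (ae_of_all _ fun ω => sq_nonneg _)
  filter_upwards [hbd, hmean, hsq] with ω hbd hmean hsq
  rw [Pi.zero_apply] at hsq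
  rw [compensatedExponent]
  nlinarith [abs_le.mp hbd]

lemma condExp_exp_compensatedExponent_le_one (hm : m ≤ mΩ) (hy : Measurable y)
    (hbd : ∀ᵐ ω ∂μ, |y ω| ≤ 3 / 5) :
    μ[fun ω => Real.exp (compensatedExponent μ m y ω) | m] ≤ᵐ[μ] fun _ => 1 := by
  set A : Ω → ℝ := fun ω => (μ[y | m]) ω - 4 * (μ[fun ω' => y ω' ^ 2 | m]) ω
  have hA : StronglyMeasurable[m] fun ω => Real.exp (A ω) :=
    (Real.measurable_exp.comp (stronglyMeasurable_condExp.measurable.sub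
      (stronglyMeasurable_condExp.measurable.const_mul 4))).stronglyMeasurable
  have hsplit : (fun ω => Real.exp (compensatedExponent μ m y ω)) =
      (fun ω => Real.exp (A ω)) * fun ω => Real.exp (-y ω + y ω ^ 2) := by
    ext ω
    rw [compensatedExponent, Real.exp_add, Pi.mul_apply]
  have hpull := condExp_mul_of_stronglyMeasurable_left hA
    (hsplit ▸ integrable_exp_of_ae_le (measurable_compensatedExponent hm hy)
      (ae_compensatedExponent_le hm hy hbd))
    (integrable_exp_neg_add_sq hy hbd)
  rw [hsplit]
  filter_upwards [hpull, condExp_exp_neg_add_sq_le hm hy hbd] with ω hpull hle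
  calc _ = Real.exp (A ω) * (μ[fun ω => Real.exp (-y ω + y ω ^ 2) | m]) ω := hpull
    _ ≤ Real.exp (A ω) * Real.exp (-A ω) := mul_le_mul_of_nonneg_left hle (Real.exp_pos _).le
    _ = 1 := by rw [← Real.exp_add, add_neg_cancel, Real.exp_zero]

lemma supermartingale_exp_sum_compensatedExponent {y : ℕ → Ω → ℝ}
    (hy : ∀ t, Measurable[ℱ (t + 1)] (y t)) (hbd : ∀ t, ∀ᵐ ω ∂μ, |y t ω| ≤ 3 / 5) :
    Supermartingale
      (fun n ω => Real.exp (∑ t ∈ Finset.range n, compensatedExponent μ (ℱ t) (y t) ω)) ℱ μ := by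
  have hmeas (t : ℕ) : Measurable (y t) := (hy t).mono (ℱ.le _) le_rfl
  exact supermartingale_exp_sum
    (fun t => measurable_compensatedExponent (ℱ.mono t.le_succ) (hy t))
    (fun t => ae_compensatedExponent_le (ℱ.le t) (hmeas t) (hbd t))
    (fun t => condExp_exp_compensatedExponent_le_one (ℱ.le t) (hmeas t) (hbd t))

end Supermartingale

section Concentration

variable {Ω : Type*} {mΩ : MeasurableSpace Ω} {μ : Measure Ω}

lemma exists_measurableSet_forall_of_ae {s : Set Ω} (hs : MeasurableSet s) {P : Ω → Prop}
    (hP : ∀ᵐ ω ∂μ, ω ∈ s → P ω) : ∃ S, MeasurableSet S ∧ μ S = μ s ∧ ∀ ω ∈ S, P ω := by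
  obtain ⟨N, hPN, hN, hN0⟩ := exists_measurable_superset_of_null (ae_iff.mp hP)
  refine ⟨s \ N, hs.diff hN, measure_sdiff_null hN0, fun ω hω => ?_⟩
  by_contra h
  exact hω.2 (hPN fun himp => h (himp hω.1))

variable [IsProbabilityMeasure μ]

lemma integral_exp_sum_le_one {ℱ : Filtration ℕ mΩ} {ξ : ℕ → Ω → ℝ}
    (hξ : Supermartingale (fun n ω => Real.exp (∑ t ∈ Finset.range n, ξ t ω)) ℱ μ) (n : ℕ) :
    ∫ ω, Real.exp (∑ t ∈ Finset.range n, ξ t ω) ∂μ ≤ 1 := by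
  simpa using hξ.setIntegral_le n.zero_le MeasurableSet.univ

lemma le_measure_lt_mul_exp {W : Ω → ℝ} (hWm : Measurable W) (hW : 0 ≤ W) (hWi : Integrable W μ)
    {N : ℝ} (hN : 0 < N) (hWN : ∫ ω, W ω ∂μ ≤ N) (x : ℝ) :
    ENNReal.ofReal (1 - Real.exp (-x)) ≤ μ {ω | W ω < N * Real.exp x} := by
  have hmarkov : μ.real {ω | N * Real.exp x ≤ W ω} ≤ Real.exp (-x) := by
    have h := (mul_meas_ge_le_integral_of_nonneg (ae_of_all _ hW) hWi (N * Real.exp x)).trans hWN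
    rw [mul_assoc] at h
    have h1 := le_of_mul_le_mul_left (h.trans_eq (mul_one N).symm) hN
    rwa [mul_comm, ← le_div_iff₀ (Real.exp_pos x), one_div, ← Real.exp_neg] at h1
  have hcompl : {ω | W ω < N * Real.exp x} = {ω | N * Real.exp x ≤ W ω}ᶜ := by
    ext ω
    simp
  rw [← ofReal_measureReal, hcompl,
    probReal_compl_eq_one_sub (measurableSet_le measurable_const hWm)]
  exact ENNReal.ofReal_le_ofReal (by linarith)

end Concentration

/-! ### Conditional regret along the run -/

section Measurability

variable {Ω : Type*} {mΩ : MeasurableSpace Ω} {ℱ : Filtration ℕ mΩ} {d K : ℕ}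
  {grad : ℕ → Ω → (Fin d → ℝ) → (Fin d → ℝ)} {E : ℝ} {T : ℕ} {prior : Fin K → ℝ}
  {θ : Fin K → Fin d → ℝ}

lemma measurable_boaPredict {m : MeasurableSpace Ω} {L : Ω → ℝ → Fin K → ℝ}
    (hL : ∀ η k, Measurable fun ω => L ω η k) :
    Measurable fun ω => boaPredict E T prior θ (L ω) := by
  have hexp (η : ℝ) (k : Fin K) : Measurable fun ω => Real.exp (η * L ω η k) :=
    Real.measurable_exp.comp ((hL η k).const_mul η)
  unfold boaPredict boaWeight
  fun_prop

lemma measurable_boaCum (hgrad : ∀ t, 1 ≤ t → Measurable[(ℱ t).prod MeasurableSpace.pi]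
      (fun p : Ω × (Fin d → ℝ) => grad t p.1 p.2)) (t : ℕ) (η : ℝ) (k : Fin K) :
    Measurable[ℱ t] fun ω => boaCum E T prior θ (fun s => grad s ω) t η k := by
  induction t generalizing η k with
  | zero => exact measurable_const
  | succ t ih =>
    have hcum (η : ℝ) (k : Fin K) : Measurable[ℱ (t + 1)] fun ω =>
        boaCum E T prior θ (fun s => grad s ω) t η k := (ih η k).mono (ℱ.mono t.le_succ) le_rfl
    have hregret := measurable_linRegret (hgrad (t + 1) t.succ_pos)
      (measurable_boaPredict (E := E) (T := T) (prior := prior) (θ := θ) hcum) (θ k)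
    exact (hcum η k).add (hregret.sub ((hregret.pow_const 2).const_mul η))

lemma measurable_boaIterate (hgrad : ∀ t, 1 ≤ t → Measurable[(ℱ t).prod MeasurableSpace.pi]
      (fun p : Ω × (Fin d → ℝ) => grad t p.1 p.2)) (t : ℕ) :
    Measurable[ℱ t] fun ω => boaIterate E T prior θ (fun s => grad s ω) t :=
  measurable_boaPredict fun η k => measurable_boaCum hgrad t η k

end Measurability

section Run

variable {Ω : Type*} {mΩ : MeasurableSpace Ω} {d : ℕ}

/-- The sum `∑_{t=1}^T E_{t-1}[r_t]` of the conditional expectations of the linearized regrets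
`r_t = ∇ℓ_t(p_{t-1})ᵀ(p_{t-1} - u)` of the predictions `p_{t-1}` against `u`. -/
noncomputable def cumCondRegret (μ : Measure Ω) (ℱ : Filtration ℕ mΩ)
    (grad : ℕ → Ω → (Fin d → ℝ) → (Fin d → ℝ)) (p : ℕ → Ω → Fin d → ℝ) (T : ℕ) (u : Fin d → ℝ)
    (ω : Ω) : ℝ :=
  ∑ t ∈ Finset.range T, (μ[fun ω' => linRegret (grad (t + 1) ω') (p t ω') u | ℱ t]) ω

/-- The sum `∑_{t=1}^T E_{t-1}[r_t²]` of the conditional second moments of the linearized regrets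
of `cumCondRegret`. -/
noncomputable def cumCondSqRegret (μ : Measure Ω) (ℱ : Filtration ℕ mΩ)
    (grad : ℕ → Ω → (Fin d → ℝ) → (Fin d → ℝ)) (p : ℕ → Ω → Fin d → ℝ) (T : ℕ) (u : Fin d → ℝ)
    (ω : Ω) : ℝ :=
  ∑ t ∈ Finset.range T, (μ[fun ω' => linRegret (grad (t + 1) ω') (p t ω') u ^ 2 | ℱ t]) ω

variable {μ : Measure Ω} {ℱ : Filtration ℕ mΩ} {K T : ℕ} {ℓ : ℕ → Ω → (Fin d → ℝ) → ℝ}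
  {grad : ℕ → Ω → (Fin d → ℝ) → (Fin d → ℝ)} {p : ℕ → Ω → Fin d → ℝ} {u : Fin d → ℝ}
  {θ : Fin K → Fin d → ℝ} {prior : Fin K → ℝ} {E G η : ℝ}

lemma ae_sum_compensatedExponent_eq (T : ℕ) :
    ∀ᵐ ω ∂μ, ∑ t ∈ Finset.range T, compensatedExponent μ (ℱ t)
        (fun ω' => η * linRegret (grad (t + 1) ω') (p t ω') u) ω =
      η * (cumCondRegret μ ℱ grad p T u ω - 4 * η * cumCondSqRegret μ ℱ grad p T u ω) -
        η * ∑ t ∈ Finset.range T, (linRegret (grad (t + 1) ω) (p t ω) u -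
          η * linRegret (grad (t + 1) ω) (p t ω) u ^ 2) := by
  have hmean (t : ℕ) := condExp_smul (μ := μ) η
    (fun ω' => linRegret (grad (t + 1) ω') (p t ω') u) (ℱ t)
  have hsq (t : ℕ) := condExp_smul (μ := μ) (η ^ 2)
    (fun ω' => linRegret (grad (t + 1) ω') (p t ω') u ^ 2) (ℱ t)
  filter_upwards [ae_all_iff.mpr hmean, ae_all_iff.mpr hsq] with ω hmean hsq
  simp only [cumCondRegret, cumCondSqRegret, Finset.mul_sum, ← Finset.sum_sub_distrib]
  refine Finset.sum_congr rfl fun t _ => ?_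
  have hmean' : (μ[fun ω' => η * linRegret (grad (t + 1) ω') (p t ω') u | ℱ t]) ω =
    η * (μ[fun ω' => linRegret (grad (t + 1) ω') (p t ω') u | ℱ t]) ω := hmean t
  have hsq' : (μ[fun ω' => η ^ 2 * linRegret (grad (t + 1) ω') (p t ω') u ^ 2 | ℱ t]) ω =
    η ^ 2 * (μ[fun ω' => linRegret (grad (t + 1) ω') (p t ω') u ^ 2 | ℱ t]) ω := hsq t
  simp only [compensatedExponent, mul_pow, hmean', hsq']
  ring

lemma ae_sum_compensatedExponent_boaIterate_eq :
    ∀ᵐ ω ∂μ, ∀ i k, ∑ t ∈ Finset.range T, compensatedExponent μ (ℱ t) (fun ω' =>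
        learningRate E i * linRegret (grad (t + 1) ω')
          (boaIterate E T prior θ (fun s => grad s ω') t) (θ k)) ω =
      learningRate E i * (cumCondRegret μ ℱ grad
          (fun t ω' => boaIterate E T prior θ (fun s => grad s ω') t) T (θ k) ω -
        4 * learningRate E i * cumCondSqRegret μ ℱ grad
          (fun t ω' => boaIterate E T prior θ (fun s => grad s ω') t) T (θ k) ω) -
      learningRate E i * boaCum E T prior θ (fun s => grad s ω) T (learningRate E i) k := by
  simp only [boaCum_eq_sum]
  exact ae_all_iff.mpr fun i => ae_all_iff.mpr fun k => ae_sum_compensatedExponent_eq T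

lemma LipschitzLoss.ae_abs_learningRate_mul_linRegret_le (hlip : LipschitzLoss μ grad G)
    (hE : 0 < E) (hGE : 4 * G ≤ 3 * E) (hp : ∀ t ω, p t ω ∈ l1Ball d) (hu : u ∈ l1Ball d) {i : ℕ}
    (hi : i ∈ rateIndices E T) (t : ℕ) :
    ∀ᵐ ω ∂μ, |learningRate E i * linRegret (grad (t + 1) ω) (p t ω) u| ≤ 3 / 5 :=
  (hlip.ae_abs_linRegret_le (hp t) hu).mono fun _ h => abs_learningRate_mul_le hE hGE hi h

/-- The mixture, over the learning rates and over the points weighted by `prior`, of the exponential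
supermartingales of the runs: Markov's inequality for it covers all rates and points at once. -/
noncomputable def mixtureExp (μ : Measure Ω) (ℱ : Filtration ℕ mΩ)
    (grad : ℕ → Ω → (Fin d → ℝ) → (Fin d → ℝ)) (p : ℕ → Ω → Fin d → ℝ) (E : ℝ) (T : ℕ)
    (prior : Fin K → ℝ) (θ : Fin K → Fin d → ℝ) (ω : Ω) : ℝ :=
  ∑ i ∈ rateIndices E T, ∑ k, prior k * Real.exp (∑ t ∈ Finset.range T, compensatedExponent μ (ℱ t)
    (fun ω' => learningRate E i * linRegret (grad (t + 1) ω') (p t ω') (θ k)) ω)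

lemma mixtureExp_nonneg (hprior : ∀ k, 0 ≤ prior k) :
    0 ≤ mixtureExp μ ℱ grad p E T prior θ := fun _ =>
  Finset.sum_nonneg fun _ _ => Finset.sum_nonneg fun k _ =>
    mul_nonneg (hprior k) (Real.exp_pos _).le

lemma measurable_mixtureExp (hloss : IsLossSequence μ ℱ ℓ grad)
    (hp : ∀ t, Measurable[ℱ t] (p t)) : Measurable (mixtureExp μ ℱ grad p E T prior θ) := by
  refine Finset.measurable_sum _ fun i _ => Finset.measurable_sum _ fun k _ => ?_
  refine (Real.measurable_exp.comp (Finset.measurable_sum _ fun t _ => ?_)).const_mul _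
  exact measurable_compensatedExponent (ℱ.le t) ((hloss.measurable_linRegret_comp
    ((hp t).mono (ℱ.le t) le_rfl) (θ k)).const_mul _)

lemma sum_mul_le_of_sum_exp_lt {N x : ℝ} (hprior : ∀ k, 0 ≤ prior k) (hN : 0 < N)
    {D : ℕ → Fin K → ℝ} (hD : ∑ i ∈ rateIndices E T, ∑ k, prior k * Real.exp (D i k) <
      N * Real.exp x) {π : Fin K → ℝ} (hπ : π ∈ stdSimplex ℝ (Fin K))
    (hac : ∀ k, prior k = 0 → π k = 0) {i : ℕ} (hi : i ∈ rateIndices E T) :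
    ∑ k, π k * D i k ≤ klFin π prior + (Real.log N + x) := by
  have hlog : Real.log (N * Real.exp x) = Real.log N + x := by
    rw [Real.log_mul hN.ne' (Real.exp_pos _).ne', Real.log_exp]
  rw [← hlog]
  refine sum_mul_le_klFin_add_log hπ hprior hac ((Finset.single_le_sum (f := fun i =>
    ∑ k, prior k * Real.exp (D i k)) (fun i _ => ?_) hi).trans hD.le)
  exact Finset.sum_nonneg fun k _ => mul_nonneg (hprior k) (Real.exp_pos _).le

lemma supermartingale_exp_sum_linRegret [IsFiniteMeasure μ] (hloss : IsLossSequence μ ℱ ℓ grad)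
    (hp : ∀ t, Measurable[ℱ t] (p t))
    (hbd : ∀ t, ∀ᵐ ω ∂μ, |η * linRegret (grad (t + 1) ω) (p t ω) u| ≤ 3 / 5) :
    Supermartingale (fun n ω => Real.exp (∑ t ∈ Finset.range n, compensatedExponent μ (ℱ t)
      (fun ω' => η * linRegret (grad (t + 1) ω') (p t ω') u) ω)) ℱ μ :=
  supermartingale_exp_sum_compensatedExponent (fun t => (hloss.measurable_linRegret_adapted
    ((hp t).mono (ℱ.mono t.le_succ) le_rfl) u).const_mul η) hbd

lemma integrable_mixtureExp [IsFiniteMeasure μ] (hloss : IsLossSequence μ ℱ ℓ grad)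
    (hlip : LipschitzLoss μ grad G) (hE : 0 < E) (hGE : 4 * G ≤ 3 * E) (hθ : ∀ k, θ k ∈ l1Ball d)
    (hp : ∀ t, Measurable[ℱ t] (p t)) (hpB : ∀ t ω, p t ω ∈ l1Ball d) :
    Integrable (mixtureExp μ ℱ grad p E T prior θ) μ :=
  integrable_finsetSum _ fun _ hi => integrable_finsetSum _ fun k _ =>
    ((supermartingale_exp_sum_linRegret hloss hp
      (hlip.ae_abs_learningRate_mul_linRegret_le hE hGE hpB (hθ k) hi)).integrable T).const_mul _

variable [IsProbabilityMeasure μ]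

lemma integral_mixtureExp_le (hloss : IsLossSequence μ ℱ ℓ grad) (hlip : LipschitzLoss μ grad G)
    (hE : 0 < E) (hGE : 4 * G ≤ 3 * E) (hprior : prior ∈ stdSimplex ℝ (Fin K))
    (hθ : ∀ k, θ k ∈ l1Ball d) (hp : ∀ t, Measurable[ℱ t] (p t)) (hpB : ∀ t ω, p t ω ∈ l1Ball d) :
    ∫ ω, mixtureExp μ ℱ grad p E T prior θ ω ∂μ ≤ (rateIndices E T).card := by
  have hsuper {i : ℕ} (hi : i ∈ rateIndices E T) (k : Fin K) :=
    supermartingale_exp_sum_linRegret hloss hp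
      (hlip.ae_abs_learningRate_mul_linRegret_le hE hGE hpB (hθ k) hi)
  have hint {i : ℕ} (hi : i ∈ rateIndices E T) (k : Fin K) :=
    ((hsuper hi k).integrable T).const_mul (prior k)
  unfold mixtureExp
  rw [integral_finsetSum _ fun i hi => integrable_finsetSum _ fun k _ => hint hi k,
    Finset.card_eq_sum_ones, Nat.cast_sum]
  refine Finset.sum_le_sum fun i hi => ?_
  rw [integral_finsetSum _ fun k _ => hint hi k, Nat.cast_one, ← hprior.2]
  refine Finset.sum_le_sum fun k _ => ?_
  rw [integral_const_mul]
  exact mul_le_of_le_one_right (hprior.1 k) (integral_exp_sum_le_one (hsuper hi k) T)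

lemma exists_measurableSet_learningRate_mul_sum_le (hloss : IsLossSequence μ ℱ ℓ grad)
    (hlip : LipschitzLoss μ grad G) (hE : 0 < E) (hGE : 4 * G ≤ 3 * E)
    (hgrid : (rateIndices E T).Nonempty) (hprior : prior ∈ stdSimplex ℝ (Fin K))
    (hθ : ∀ k, θ k ∈ l1Ball d) (x : ℝ) :
    ∃ S, MeasurableSet S ∧ ENNReal.ofReal (1 - Real.exp (-x)) ≤ μ S ∧ ∀ ω ∈ S,
      ∀ π ∈ stdSimplex ℝ (Fin K), (∀ k, prior k = 0 → π k = 0) → ∀ i ∈ rateIndices E T,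
        learningRate E i * ∑ k, π k * cumCondRegret μ ℱ grad
            (fun t ω' => boaIterate E T prior θ (fun s => grad s ω') t) T (θ k) ω ≤
          4 * learningRate E i ^ 2 * ∑ k, π k * cumCondSqRegret μ ℱ grad
            (fun t ω' => boaIterate E T prior θ (fun s => grad s ω') t) T (θ k) ω +
          (2 * (klFin π prior + Real.log (rateIndices E T).card) + x) := by
  set p : ℕ → Ω → Fin d → ℝ := fun t ω' => boaIterate E T prior θ (fun s => grad s ω') t with hp
  have hpm (t : ℕ) : Measurable[ℱ t] (p t) := measurable_boaIterate hloss.measurable_grad t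
  have hpB (t : ℕ) (ω : Ω) : p t ω ∈ l1Ball d := boaIterate_mem_l1Ball hE hgrid hprior hθ t
  have hcard : (0 : ℝ) < (rateIndices E T).card := by exact_mod_cast hgrid.card_pos
  have hWm := measurable_mixtureExp (E := E) (T := T) (prior := prior) (θ := θ) hloss hpm
  have hprob := le_measure_lt_mul_exp hWm (mixtureExp_nonneg hprior.1)
    (integrable_mixtureExp hloss hlip hE hGE hθ hpm hpB) hcard
    (integral_mixtureExp_le hloss hlip hE hGE hprior hθ hpm hpB) x
  obtain ⟨S, hS, hμS, hbound⟩ := exists_measurableSet_forall_of_ae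
    (measurableSet_lt hWm measurable_const)
    ((ae_sum_compensatedExponent_boaIterate_eq (μ := μ) (ℱ := ℱ) (grad := grad) (E := E) (T := T)
      (prior := prior) (θ := θ)).and hlip.ae_forall_norm_le |>.mono fun ω h hω =>
        And.intro hω h)
  refine ⟨S, hS, hμS ▸ hprob, fun ω hω π hπ hac i hi => ?_⟩
  obtain ⟨hmix, hexponent, hnorm⟩ := hbound ω hω
  have hdev := sum_mul_le_of_sum_exp_lt hprior.1 hcard hmix hπ hac hi
  have hregret := learningRate_mul_sum_boaCum_le (g := fun s => grad s ω) hE hGE hprior hθ hnorm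
    hπ hac hi T
  simp only [hp, hexponent] at hdev
  simp only [mul_sub, Finset.sum_sub_distrib] at hdev
  simp only [mul_left_comm (π _), ← Finset.mul_sum] at hdev
  linarith

end Run

/-! ### Tuning the learning rate -/

section LearningRate

variable {E : ℝ} {T : ℕ}

lemma learningRate_le_three_mul_succ (hE : 0 < E) (i : ℕ) :
    learningRate E i ≤ 3 * learningRate E (i + 1) := by
  have hsucc : learningRate E i = Real.exp 1 * learningRate E (i + 1) := by
    rw [learningRate, learningRate, Nat.cast_succ, Real.exp_add, mul_assoc,
      mul_inv_rev, mul_inv_rev, mul_inv_rev]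
    field_simp
  rw [hsucc]
  exact mul_le_mul_of_nonneg_right Real.exp_one_lt_three.le (learningRate_pos hE _).le

lemma sq_mul_learningRate_floor_le (hE : 0 < E) :
    E ^ 2 * T * learningRate E ⌊Real.log (E * T)⌋₊ ≤ 3 := by
  set N := ⌊Real.log (E * T)⌋₊
  calc E ^ 2 * T * learningRate E N = E * T * Real.exp (-N) := by rw [← learningRate_mul hE]; ring
    _ ≤ Real.exp (N + 1) * Real.exp (-N) := by
        gcongr
        exact (Real.le_exp_log _).trans (Real.exp_le_exp.mpr (Nat.lt_floor_add_one _).le)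
    _ = Real.exp 1 := by rw [← Real.exp_add]; ring_nf
    _ ≤ 3 := Real.exp_one_lt_three.le

lemma exists_mem_rateIndices_near (hE : 0 < E) (hgrid : (rateIndices E T).Nonempty) {ρ : ℝ}
    (hρ : ρ < E⁻¹) :
    ∃ i ∈ rateIndices E T, ρ ≤ 3 * learningRate E i ∧
      (learningRate E i ≤ ρ ∨ E ^ 2 * T * learningRate E i ≤ 3) := by
  have hN := Finset.right_mem_Icc.mpr (Finset.nonempty_Icc.mp hgrid)
  set N := ⌊Real.log (E * T)⌋₊
  rcases lt_or_ge ρ (learningRate E N) with hlt | hge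
  · exact ⟨N, hN, by linarith [learningRate_pos hE N], .inr (sq_mul_learningRate_floor_le hE)⟩
  classical
  have hex : ∃ i, learningRate E i ≤ ρ := ⟨N, hge⟩
  have h0 : Nat.find hex ≠ 0 := by
    rw [Ne, Nat.find_eq_zero, not_le]
    simpa [learningRate] using hρ
  obtain ⟨j, hj⟩ := Nat.exists_eq_succ_of_ne_zero h0
  refine ⟨Nat.find hex, Finset.mem_Icc.mpr ⟨Nat.one_le_iff_ne_zero.mpr h0, Nat.find_min' hex hge⟩,
    ?_, .inl (Nat.find_spec hex)⟩
  have hprev : ρ < learningRate E j := not_le.mp (Nat.find_min hex (hj ▸ j.lt_succ_self))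
  exact hj ▸ hprev.le.trans (learningRate_le_three_mul_succ hE j)

/-- The learning rate `1 / (4κ)` turns `4ηV` into `S + b`; below the smallest learning rate, `4ηV`
is bounded. -/
lemma le_add_of_forall_learningRate_mul_le {κ b B Q S V : ℝ} (hE : 0 < E)
    (hgrid : (rateIndices E T).Nonempty) (hκ : E < 4 * κ) (hB : 0 ≤ B) (hSb : 0 ≤ S + b)
    (hVS : V ≤ κ * (S + b)) (hV : 4 * V ≤ 9 * (E ^ 2 * T))
    (hQ : ∀ i ∈ rateIndices E T, learningRate E i * Q ≤ 4 * learningRate E i ^ 2 * V + B) :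
    Q ≤ S + b + 12 * κ * B + 27 := by
  have hκ4 : 0 < 4 * κ := hE.trans hκ
  obtain ⟨i, hi, hnear, hcase⟩ := exists_mem_rateIndices_near hE hgrid (inv_strictAnti₀ hE hκ)
  have hη := learningRate_pos hE i
  have hQi := hQ i hi
  set η := learningRate E i
  have hκη : 1 ≤ 12 * κ * η := by
    rw [inv_le_iff_one_le_mul₀ hκ4] at hnear
    linarith
  have hvar : 4 * η * V ≤ S + b + 27 := by
    rcases hcase with hle | hlast
    · have hηκ : η * (4 * κ) ≤ 1 := (le_inv_mul_iff₀' hκ4).mp (by simpa using hle)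
      nlinarith [mul_le_mul_of_nonneg_left hVS hη.le, mul_le_mul_of_nonneg_right hηκ hSb]
    · nlinarith [mul_le_mul_of_nonneg_left hV hη.le]
  have hcost : B ≤ η * (12 * κ * B) := by nlinarith [mul_le_mul_of_nonneg_right hκη hB]
  refine le_of_mul_le_mul_left (hQi.trans ?_) hη
  nlinarith [mul_le_mul_of_nonneg_left hvar hη.le]

end LearningRate

section Rate

variable {α β a τ : ℝ}

lemma mul_rpow_balance (hα : 0 < α) (ha : 0 < a) (hτ : 0 < τ) (hβ : β < 2) :
    a * ((a / (α * τ)) ^ (1 / (2 - β))) ^ (β - 1) / α = τ * (a / (α * τ)) ^ (1 / (2 - β)) := by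
  have hβ' : 2 - β ≠ 0 := by linarith
  have hbase : 0 < a / (α * τ) := by positivity
  set z := a / (α * τ) with hz
  have hexponent : z * (z ^ (1 / (2 - β))) ^ (β - 1) = z ^ (1 / (2 - β)) := by
    rw [← Real.rpow_mul hbase.le, ← Real.rpow_one_add' hbase.le]
    · congr 1; field_simp; ring
    · field_simp; ring_nf; simpa using hβ'
  calc a * (z ^ (1 / (2 - β))) ^ (β - 1) / α = τ * (z * (z ^ (1 / (2 - β))) ^ (β - 1)) := by
        rw [hz]; field_simp
    _ = τ * z ^ (1 / (2 - β)) := by rw [hexponent]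

lemma sub_le_of_forall_rpow {G B Q S V : ℝ} {T : ℕ} (hG : 0 < G) (hα : 0 < α) (hβ1 : β ≤ 1)
    (hT : 1 ≤ T) (hgrid : (rateIndices (4 * G / 3) T).Nonempty) (ha : 0 < a) (hB : 0 ≤ B)
    (hBa : B ≤ 6 * a) (hS : 0 ≤ S) (hV : V ≤ T * (4 * G ^ 2))
    (hVS : ∀ c : ℝ, 0 < c → V ≤ (c ^ (β - 1) / α + 4 * G) * S + T * (c ^ β / α))
    (hQ : ∀ i ∈ rateIndices (4 * G / 3) T, learningRate (4 * G / 3) i * Q ≤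
      4 * learningRate (4 * G / 3) i ^ 2 * V + B) :
    Q - S ≤ 300 * (T * (a / (α * T)) ^ (1 / (2 - β)) + G * a + 1) := by
  have hT' : (0 : ℝ) < T := by exact_mod_cast hT
  have hbalance := mul_rpow_balance hα ha hT' (by linarith : β < 2)
  set c := (a / (α * T)) ^ (1 / (2 - β))
  have hc : 0 < c := by positivity
  have hvar : T * (c ^ β / α) = c ^ (β - 1) / α * (T * c) := by
    have hpow := Real.rpow_sub_one hc.ne' β
    rw [hpow]
    field_simp
  set κ := c ^ (β - 1) / α + 4 * G with hκ
  have hκG : 4 * G < κ := lt_add_of_pos_left _ (by positivity)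
  have hVκ : V ≤ κ * (S + T * c) := by nlinarith [hVS c hc, mul_pos hT' hc]
  have htune := le_add_of_forall_learningRate_mul_le (by positivity) hgrid
    (by linarith : 4 * G / 3 < 4 * κ) hB (by positivity) hVκ (by linarith) hQ
  have hcost : 12 * κ * B ≤ 72 * (T * c) + 288 * (G * a) :=
    calc 12 * κ * B ≤ 12 * κ * (6 * a) := by gcongr
      _ = 72 * (a * c ^ (β - 1) / α) + 288 * (G * a) := by rw [hκ]; ring
      _ = _ := by rw [hbalance]
  linarith [mul_pos hT' hc, mul_pos hG ha]

lemma mul_rpow_le_rpow_div {G : ℝ} (hα : 0 < α) (hβ : β < 2) (hG : 0 ≤ G)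
    (hαG : α * G ^ (2 - β) ≤ 1) (ha : 0 ≤ a) (hτ : 0 ≤ τ) :
    G * (a / τ) ^ (1 / (2 - β)) ≤ (a / (α * τ)) ^ (1 / (2 - β)) := by
  have hβ' : 0 < 2 - β := by linarith
  have haτ : 0 ≤ a / τ := by positivity
  calc G * (a / τ) ^ (1 / (2 - β)) = (G ^ (2 - β) * (a / τ)) ^ (1 / (2 - β)) := by
        rw [Real.mul_rpow (by positivity) haτ, one_div, Real.rpow_rpow_inv hG hβ'.ne']
    _ ≤ (1 / α * (a / τ)) ^ (1 / (2 - β)) := by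
        gcongr
        rwa [le_div_iff₀ hα, mul_comm]
    _ = (a / (α * τ)) ^ (1 / (2 - β)) := by rw [div_mul_div_comm, one_mul]

/-- When `a ≤ T`, the `O(1/T)` terms are of the order of `G * (a/T) ≤ G * (a/T)^(1/(2-β))`;
otherwise the trivial bound `2 * G` is of the right order. -/
lemma le_rpow_of_le_add {G r : ℝ} (hα : 0 < α) (hβ1 : β ≤ 1) (hτ : 0 < τ) (ha : 1 / 4 ≤ a)
    (hG1 : 1 ≤ G) (hαG : α * G ^ (2 - β) ≤ 1)
    (hr : r ≤ 300 * ((a / (α * τ)) ^ (1 / (2 - β)) + (G * a + 1) / τ)) (hrG : r ≤ 2 * G) :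
    r ≤ 1800 * (a / (α * τ)) ^ (1 / (2 - β)) := by
  have hscale : G * (a / τ) ^ (1 / (2 - β)) ≤ (a / (α * τ)) ^ (1 / (2 - β)) :=
    mul_rpow_le_rpow_div hα (by linarith) (by linarith) hαG (by linarith) hτ.le
  have haτ : 0 < a / τ := by positivity
  set c := (a / (α * τ)) ^ (1 / (2 - β))
  rcases le_total (a / τ) 1 with hle | hge
  · have hlin : (G * a + 1) / τ ≤ 5 * (G * (a / τ)) := by
      rw [← mul_div_assoc, ← mul_div_assoc]
      gcongr
      nlinarith
    have hpow : G * (a / τ) ≤ G * (a / τ) ^ (1 / (2 - β)) := by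
      gcongr
      exact Real.self_le_rpow_of_le_one haτ.le hle
        (by rw [div_le_one (by linarith)]; linarith)
    linarith
  · have hpow : G ≤ G * (a / τ) ^ (1 / (2 - β)) :=
      le_mul_of_one_le_right (by linarith)
        (Real.one_le_rpow hge (one_div_nonneg.mpr (by linarith)))
    linarith

end Rate

section Complexity

variable {G : ℝ} {T : ℕ}

lemma rateIndices_nonempty {E : ℝ} (hgrid : 1 ≤ Real.log (E * T)) : (rateIndices E T).Nonempty :=
  Finset.nonempty_Icc.mpr ((Nat.one_le_floor_iff _).mpr hgrid)

lemma log_four_mul_div_three_mul_le (hgrid : 1 ≤ Real.log (4 * G / 3 * T)) :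
    Real.log (4 * G / 3 * T) ≤ Real.log (G * T) + 1 / 3 := by
  have hfactor : 4 * G / 3 * T = 4 / 3 * (G * T) := by ring
  have hGT : G * T ≠ 0 := fun h => by norm_num [hfactor, h] at hgrid
  have hlog := Real.log_le_sub_one_of_pos (show (0 : ℝ) < 4 / 3 by norm_num)
  calc Real.log (4 * G / 3 * T) = Real.log (4 / 3) + Real.log (G * T) := by
        rw [hfactor, Real.log_mul (by norm_num) hGT]
    _ ≤ Real.log (G * T) + 1 / 3 := by linarith

lemma one_fourth_le_log_log_add (hgrid : 1 ≤ Real.log (4 * G / 3 * T)) :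
    1 / 4 ≤ Real.log (Real.log (G * T)) + Real.log 2 := by
  have hL := hgrid.trans (log_four_mul_div_three_mul_le hgrid)
  have hlog := Real.one_sub_inv_le_log_of_pos (show (0 : ℝ) < 4 / 3 by norm_num)
  calc (1 / 4 : ℝ) ≤ Real.log (4 / 3) := by linarith
    _ ≤ Real.log (Real.log (G * T) * 2) := Real.log_le_log (by norm_num) (by linarith)
    _ = _ := Real.log_mul (by linarith) two_ne_zero

lemma log_card_rateIndices_le (hgrid : 1 ≤ Real.log (4 * G / 3 * T)) :
    Real.log (rateIndices (4 * G / 3) T).card ≤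
      3 * Real.log (Real.log (G * T)) + 2 * Real.log 2 := by
  have hlog := log_four_mul_div_three_mul_le hgrid
  set L := Real.log (G * T)
  have hL : 2 / 3 ≤ L := by linarith
  have hcard : ((rateIndices (4 * G / 3) T).card : ℝ) ≤ L + 1 / 3 := by
    rw [rateIndices, Nat.card_Icc, Nat.add_sub_cancel]
    exact (Nat.floor_le (by linarith)).trans hlog
  have hcard0 : (0 : ℝ) < (rateIndices (4 * G / 3) T).card := by
    exact_mod_cast (rateIndices_nonempty hgrid).card_pos
  calc Real.log (rateIndices (4 * G / 3) T).card ≤ Real.log (L ^ 3 * 2 ^ 2) := by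
        refine Real.log_le_log hcard0 (hcard.trans ?_)
        nlinarith [mul_nonneg (sub_nonneg.mpr hL) (sub_nonneg.mpr hL),
          mul_nonneg (by linarith : 0 ≤ L) (mul_nonneg (sub_nonneg.mpr hL) (sub_nonneg.mpr hL))]
    _ = 3 * Real.log L + 2 * Real.log 2 := by
        rw [Real.log_mul (by positivity) (by norm_num), Real.log_pow, Real.log_pow]
        norm_num

end Complexity

/-! ### From linearized regret to risk -/

section Risk

variable {Ω : Type*} {mΩ : MeasurableSpace Ω} {d : ℕ}

/-- The sum `∑_{t=1}^T E_{t-1}[∇ℓ_t(p_{t-1})ᵀ(p_{t-1} - u) - (ℓ_t(p_{t-1}) - ℓ_t(u))]` of the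
conditional linearization gaps: what linearization loses in the risk of the predictions. -/
noncomputable def cumCondGap (μ : Measure Ω) (ℱ : Filtration ℕ mΩ)
    (ℓ : ℕ → Ω → (Fin d → ℝ) → ℝ) (grad : ℕ → Ω → (Fin d → ℝ) → (Fin d → ℝ))
    (p : ℕ → Ω → Fin d → ℝ) (T : ℕ) (u : Fin d → ℝ) (ω : Ω) : ℝ :=
  ∑ t ∈ Finset.range T,
    (μ[fun ω' => linGap (ℓ (t + 1) ω') (grad (t + 1) ω') (p t ω') u | ℱ t]) ω

variable {μ : Measure Ω} {ℱ : Filtration ℕ mΩ} {T : ℕ} {ℓ : ℕ → Ω → (Fin d → ℝ) → ℝ}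
  {grad : ℕ → Ω → (Fin d → ℝ) → (Fin d → ℝ)} {p : ℕ → Ω → Fin d → ℝ} {u : Fin d → ℝ}
  {G α β : ℝ}

lemma mul_avgRisk_eq (hT : T ≠ 0) (ω : Ω) :
    T * avgRisk μ ℱ ℓ p T u ω = ∑ t ∈ Finset.range T,
      ((μ[fun ω' => ℓ (t + 1) ω' (p t ω') | ℱ t]) ω - (μ[fun ω' => ℓ (t + 1) ω' u | ℱ t]) ω) := by
  have hshift (f : ℕ → ℝ) : ∑ t ∈ Finset.Icc 1 T, f t = ∑ t ∈ Finset.range T, f (t + 1) := by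
    rw [Finset.range_eq_Ico, Finset.sum_Ico_add' f 0 T 1]
    rfl
  rw [avgRisk, hshift, hshift, Finset.sum_sub_distrib]
  simp only [Nat.add_sub_cancel]
  field_simp

namespace IsLossSequence

lemma ae_cumCondGap_nonneg (hloss : IsLossSequence μ ℱ ℓ grad) (hp : ∀ t ω, p t ω ∈ l1Ball d)
    (T : ℕ) (u : Fin d → ℝ) : ∀ᵐ ω ∂μ, 0 ≤ cumCondGap μ ℱ ℓ grad p T u ω := by
  have hround (t : ℕ) : 0 ≤ᵐ[μ]
      μ[fun ω => linGap (ℓ (t + 1) ω) (grad (t + 1) ω) (p t ω) u | ℱ t] :=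
    condExp_nonneg (ae_of_all _ fun ω => linGap_nonneg (hloss.isSubgradientAt t ω (hp t ω)))
  filter_upwards [ae_all_iff.mpr hround] with ω h
  exact Finset.sum_nonneg fun t _ => h t

variable [IsFiniteMeasure μ]

lemma ae_mul_avgRisk_eq_sub (hloss : IsLossSequence μ ℱ ℓ grad) (hlip : LipschitzLoss μ grad G)
    (hpm : ∀ t, Measurable[ℱ t] (p t)) (hp : ∀ t ω, p t ω ∈ l1Ball d) (hu : u ∈ l1Ball d)
    (hT : T ≠ 0) :
    ∀ᵐ ω ∂μ, T * avgRisk μ ℱ ℓ p T u ω =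
      cumCondRegret μ ℱ grad p T u ω - cumCondGap μ ℱ ℓ grad p T u ω := by
  have hround (t : ℕ) := hloss.condExp_linGap (t := t) hlip ((hpm t).mono (ℱ.le t) le_rfl) (hp t) hu
  filter_upwards [ae_all_iff.mpr hround] with ω h
  rw [mul_avgRisk_eq hT, cumCondRegret, cumCondGap, ← Finset.sum_sub_distrib]
  refine Finset.sum_congr rfl fun t _ => ?_
  rw [h t, Pi.sub_apply, Pi.sub_apply, sub_sub_cancel]

lemma ae_cumCondRegret_le (hloss : IsLossSequence μ ℱ ℓ grad) (hlip : LipschitzLoss μ grad G)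
    (hpm : ∀ t, Measurable[ℱ t] (p t)) (hp : ∀ t ω, p t ω ∈ l1Ball d) (hu : u ∈ l1Ball d)
    (T : ℕ) : ∀ᵐ ω ∂μ, cumCondRegret μ ℱ grad p T u ω ≤ T * (2 * G) := by
  have hround (t : ℕ) := condExp_le_const (ℱ.le t)
    (hloss.integrable_linRegret (t := t) hlip ((hpm t).mono (ℱ.le t) le_rfl) (hp t) hu)
    ((hlip.ae_abs_linRegret_le (hp t) hu).mono fun _ h => (le_abs_self _).trans h)
  filter_upwards [ae_all_iff.mpr hround] with ω h
  simpa [cumCondRegret] using Finset.sum_le_card_nsmul (Finset.range T) _ _ fun t _ => h t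

lemma ae_cumCondSqRegret_le (hloss : IsLossSequence μ ℱ ℓ grad) (hlip : LipschitzLoss μ grad G)
    (hpm : ∀ t, Measurable[ℱ t] (p t)) (hp : ∀ t ω, p t ω ∈ l1Ball d) (hu : u ∈ l1Ball d)
    (T : ℕ) : ∀ᵐ ω ∂μ, cumCondSqRegret μ ℱ grad p T u ω ≤ T * (4 * G ^ 2) := by
  have hround (t : ℕ) := condExp_le_const (ℱ.le t)
    (hloss.integrable_sq_linRegret (t := t) hlip ((hpm t).mono (ℱ.le t) le_rfl) (hp t) hu)
    (hlip.ae_sq_linRegret_le (hp t) hu)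
  filter_upwards [ae_all_iff.mpr hround] with ω h
  simpa [cumCondSqRegret] using Finset.sum_le_card_nsmul (Finset.range T) _ _ fun t _ => h t

end IsLossSequence

lemma WeakExpConcave.ae_cumCondSqRegret_le [IsFiniteMeasure μ]
    (hexp : WeakExpConcave μ ℱ ℓ grad α β) (hloss : IsLossSequence μ ℱ ℓ grad)
    (hlip : LipschitzLoss μ grad G) (hα : 0 < α) (hβ : 0 ≤ β) (hβ1 : β ≤ 1)
    (hpm : ∀ t, Measurable[ℱ t] (p t)) (hp : ∀ t ω, p t ω ∈ l1Ball d) (hu : u ∈ l1Ball d)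
    (T : ℕ) :
    ∀ᵐ ω ∂μ, ∀ c : ℝ, 0 < c → cumCondSqRegret μ ℱ grad p T u ω ≤
      (c ^ (β - 1) / α + 4 * G) * cumCondGap μ ℱ ℓ grad p T u ω + T * (c ^ β / α) := by
  have hround (t : ℕ) :=
    hexp.ae_condExp_sq_linRegret_le hloss hlip hα hβ hβ1 (hpm t) (hp t) hu
  filter_upwards [ae_all_iff.mpr hround] with ω h c hc
  rw [cumCondSqRegret, cumCondGap, Finset.mul_sum]
  calc _ ≤ ∑ t ∈ Finset.range T, _ := Finset.sum_le_sum fun t _ => h t c hc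
    _ = _ := by rw [Finset.sum_add_distrib, Finset.sum_const, Finset.card_range, nsmul_eq_mul]

end Risk

lemma sum_mul_le_of_forall_le {ι : Type*} [Fintype ι] {π f : ι → ℝ} {b : ℝ}
    (hπ : π ∈ stdSimplex ℝ ι) (h : ∀ k, f k ≤ b) : ∑ k, π k * f k ≤ b :=
  calc ∑ k, π k * f k ≤ ∑ k, π k * b :=
        Finset.sum_le_sum fun k _ => mul_le_mul_of_nonneg_left (h k) (hπ.1 k)
    _ = b := by rw [← Finset.sum_mul, hπ.2, one_mul]

/-- Here `r`, `q`, `s` and `v` stand for the average risks of the points, and for the sums of their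
conditional linearized regrets, linearization gaps and second moments. -/
lemma sum_mul_risk_le {K T : ℕ} {π r q s v : Fin K → ℝ} {G α β a B : ℝ}
    (hπ : π ∈ stdSimplex ℝ (Fin K)) (hG : 0 < G) (hα : 0 < α) (hβ1 : β ≤ 1) (hT : 1 ≤ T)
    (hgrid : (rateIndices (4 * G / 3) T).Nonempty) (ha : 0 < a) (hB : 0 ≤ B) (hBa : B ≤ 6 * a)
    (hr : ∀ k, T * r k = q k - s k) (hs : ∀ k, 0 ≤ s k) (hq : ∀ k, q k ≤ T * (2 * G))
    (hv : ∀ k, v k ≤ T * (4 * G ^ 2))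
    (hvs : ∀ k, ∀ c : ℝ, 0 < c → v k ≤ (c ^ (β - 1) / α + 4 * G) * s k + T * (c ^ β / α))
    (hrate : ∀ i ∈ rateIndices (4 * G / 3) T, learningRate (4 * G / 3) i * ∑ k, π k * q k ≤
      4 * learningRate (4 * G / 3) i ^ 2 * ∑ k, π k * v k + B) :
    ∑ k, π k * r k ≤ 300 * ((a / (α * T)) ^ (1 / (2 - β)) + (G * a + 1) / T) ∧
      ∑ k, π k * r k ≤ 2 * G := by
  have hT' : (0 : ℝ) < T := by exact_mod_cast hT
  have hsum : T * ∑ k, π k * r k = ∑ k, π k * q k - ∑ k, π k * s k := by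
    simp only [Finset.mul_sum, mul_left_comm _ (π _), hr, mul_sub, Finset.sum_sub_distrib]
  have hsum_nonneg : 0 ≤ ∑ k, π k * s k :=
    Finset.sum_nonneg fun k _ => mul_nonneg (hπ.1 k) (hs k)
  have hvar (c : ℝ) (hc : 0 < c) : ∑ k, π k * v k ≤
      (c ^ (β - 1) / α + 4 * G) * ∑ k, π k * s k + T * (c ^ β / α) := by
    have h := sum_mul_le_of_forall_le hπ fun k => sub_le_iff_le_add'.mpr (hvs k c hc)
    simp only [mul_sub, Finset.sum_sub_distrib, mul_left_comm (π _), ← Finset.mul_sum] at h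
    linarith
  have hmain := sub_le_of_forall_rpow hG hα hβ1 hT hgrid ha hB hBa hsum_nonneg
    (sum_mul_le_of_forall_le hπ hv) hvar hrate
  have htrivial := sum_mul_le_of_forall_le hπ hq
  constructor
  · refine le_of_mul_le_mul_left (hsum.trans_le (hmain.trans_eq ?_)) hT'
    field_simp
    ring
  · exact le_of_mul_le_mul_left (by linarith) hT'

lemma exists_measurableSet_sum_mul_avgRisk_le {Ω : Type*} {mΩ : MeasurableSpace Ω} {μ : Measure Ω}
    [IsProbabilityMeasure μ] {ℱ : Filtration ℕ mΩ} {d K T : ℕ} {ℓ : ℕ → Ω → (Fin d → ℝ) → ℝ}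
    {grad : ℕ → Ω → (Fin d → ℝ) → (Fin d → ℝ)} {θ : Fin K → Fin d → ℝ} {prior : Fin K → ℝ}
    {G α β x : ℝ} (hθ : ∀ k, θ k ∈ l1Ball d) (hprior : prior ∈ stdSimplex ℝ (Fin K)) (hG : 0 < G)
    (hα : 0 < α) (hβ : 0 ≤ β) (hβ1 : β ≤ 1) (hx : Real.log 2 ≤ x) (hT : 1 ≤ T)
    (hgrid : 1 ≤ Real.log (4 * G / 3 * T)) (hloss : IsLossSequence μ ℱ ℓ grad)
    (hlip : LipschitzLoss μ grad G) (hexp : WeakExpConcave μ ℱ ℓ grad α β) :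
    ∃ S : Set Ω, MeasurableSet S ∧ ENNReal.ofReal (1 - Real.exp (-x)) ≤ μ S ∧ ∀ ω ∈ S,
      ∀ π ∈ stdSimplex ℝ (Fin K), (∀ k, prior k = 0 → π k = 0) →
        let a := klFin π prior + Real.log (Real.log (G * T)) + x
        let risk := ∑ k, π k * avgRisk μ ℱ ℓ
          (fun t ω' => boaIterate (4 * G / 3) T prior θ (fun s => grad s ω') t) T (θ k) ω
        1 / 4 ≤ a ∧ risk ≤ 300 * ((a / (α * T)) ^ (1 / (2 - β)) + (G * a + 1) / T) ∧
          risk ≤ 2 * G := by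
  have hE : 0 < 4 * G / 3 := by positivity
  have hne := rateIndices_nonempty hgrid
  set p : ℕ → Ω → Fin d → ℝ := fun t ω =>
    boaIterate (4 * G / 3) T prior θ (fun s => grad s ω) t
  have hpm (t : ℕ) : Measurable[ℱ t] (p t) := measurable_boaIterate hloss.measurable_grad t
  have hpB (t : ℕ) (ω : Ω) : p t ω ∈ l1Ball d := boaIterate_mem_l1Ball hE hne hprior hθ t
  obtain ⟨S₀, hS₀, hμS₀, hrate⟩ := exists_measurableSet_learningRate_mul_sum_le hloss hlip hE
    (by linarith) hne hprior hθ x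
  have hae := ae_all_iff.mpr fun k =>
    (hloss.ae_mul_avgRisk_eq_sub hlip hpm hpB (hθ k) (Nat.one_le_iff_ne_zero.mp hT)).and <|
    (hloss.ae_cumCondGap_nonneg hpB T (θ k)).and <|
    (hloss.ae_cumCondRegret_le hlip hpm hpB (hθ k) T).and <|
    (hloss.ae_cumCondSqRegret_le hlip hpm hpB (hθ k) T).and <|
    hexp.ae_cumCondSqRegret_le hloss hlip hα hβ hβ1 hpm hpB (hθ k) T
  obtain ⟨S, hS, hμS, hbound⟩ := exists_measurableSet_forall_of_ae hS₀
    (hae.mono fun ω h hω => And.intro hω h)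
  refine ⟨S, hS, hμS ▸ hμS₀, fun ω hω π hπ hac => ?_⟩
  obtain ⟨hω₀, hk⟩ := hbound ω hω
  have hKL := klFin_nonneg hπ hprior hac
  have hloglog := one_fourth_le_log_log_add hgrid
  have hcard := log_card_rateIndices_le hgrid
  have hcard0 := Real.log_natCast_nonneg (rateIndices (4 * G / 3) T).card
  have hlog2 := Real.log_pos one_lt_two
  refine ⟨by linarith, sum_mul_risk_le hπ hG hα hβ1 hT hne (by linarith) (by linarith)
    (by linarith) (fun k => (hk k).1) (fun k => (hk k).2.1) (fun k => (hk k).2.2.1)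
    (fun k => (hk k).2.2.2.1) (fun k => (hk k).2.2.2.2) (hrate ω hω₀ π hπ hac)⟩

lemma one_sub_two_mul_exp_neg_nonpos {x : ℝ} (hx : x ≤ Real.log 2) :
    1 - 2 * Real.exp (-x) ≤ 0 := by
  have hexp : Real.exp x ≤ 2 := (Real.le_log_iff_exp_le two_pos).mp hx
  rw [sub_nonpos, Real.exp_neg, ← div_eq_mul_inv, one_le_div (Real.exp_pos x)]
  exact hexp

end OnlineBOA

theorem theorem1 :
    ∃ C : ℝ, 0 < C ∧
      ∀ (Ω : Type*) (mΩ : MeasurableSpace Ω) (μ : Measure Ω) (_ : IsProbabilityMeasure μ)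
        (ℱ : Filtration ℕ mΩ) (d K T : ℕ)
        (ℓ : ℕ → Ω → (Fin d → ℝ) → ℝ) (grad : ℕ → Ω → (Fin d → ℝ) → (Fin d → ℝ))
        (θ : Fin K → Fin d → ℝ) (prior : Fin K → ℝ) (G α β x : ℝ),
        (∀ k, θ k ∈ OnlineBOA.l1Ball d) →
        prior ∈ stdSimplex ℝ (Fin K) →
        0 < G → 0 < α → 0 ≤ β → β ≤ 1 → 0 < x → 1 ≤ T →
        -- the grid of learning rates is not empty
        1 ≤ Real.log (4 * G / 3 * T) →
        OnlineBOA.IsLossSequence μ ℱ ℓ grad →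
        OnlineBOA.LipschitzLoss μ grad G →
        OnlineBOA.WeakExpConcave μ ℱ ℓ grad α β →
        ∃ S : Set Ω, MeasurableSet S ∧ ENNReal.ofReal (1 - 2 * Real.exp (-x)) ≤ μ S ∧
          ∀ ω ∈ S, ∀ π ∈ stdSimplex ℝ (Fin K),
            -- otherwise the Kullback-Leibler divergence is infinite
            (∀ k, prior k = 0 → π k = 0) →
            let a : ℝ := OnlineBOA.klFin π prior + Real.log (Real.log (G * T)) + x
            let risk : ℝ := ∑ k, π k * OnlineBOA.avgRisk μ ℱ ℓ
              (fun t ω' => OnlineBOA.boaIterate (4 * G / 3) T prior θ (fun s => grad s ω') t)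
              T (θ k) ω
            risk ≤ C * ((a / (α * T)) ^ (1 / (2 - β)) + (G * a + 1) / T) ∧
            (1 ≤ G → α * G ^ (2 - β) ≤ 1 → risk ≤ C * (a / (α * T)) ^ (1 / (2 - β))) := by
  refine ⟨1800, by norm_num, ?_⟩
  intro Ω mΩ μ _ ℱ d K T ℓ grad θ prior G α β x hθ hprior hG hα hβ hβ1 _ hT hgrid hloss hlip hexp
  rcases le_total x (Real.log 2) with hx | hx
  · refine ⟨∅, .empty, ?_, by simp⟩
    rw [ENNReal.ofReal_of_nonpos (OnlineBOA.one_sub_two_mul_exp_neg_nonpos hx)]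
    exact zero_le
  obtain ⟨S, hS, hμS, hrisk⟩ := OnlineBOA.exists_measurableSet_sum_mul_avgRisk_le hθ hprior hG hα
    hβ hβ1 hx hT hgrid hloss hlip hexp
  have hprob : 1 - 2 * Real.exp (-x) ≤ 1 - Real.exp (-x) := by linarith [Real.exp_pos (-x)]
  refine ⟨S, hS, (ENNReal.ofReal_le_ofReal hprob).trans hμS, fun ω hω π hπ hac => ?_⟩
  obtain ⟨ha, hslow, htrivial⟩ := hrisk ω hω π hπ hac
  have hT' : (0 : ℝ) < T := by exact_mod_cast hT
  refine ⟨hslow.trans (mul_le_mul_of_nonneg_right (by norm_num) ?_), fun hG1 hαG =>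
    OnlineBOA.le_rpow_of_le_add hα hβ1 hT' ha hG1 hαG hslow htrivial⟩
  have ha0 := (show (0 : ℝ) ≤ 1 / 4 by norm_num).trans ha
  positivity
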